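/- Let $R$ be a finite commutative local ring with maximal ideal $\mathfrak m$, and let $\xi$ be a random element of $R$ whose distribution is not concentrated on a translate $r+I$ of a proper ideal $I\subsetneq R$, nor on an affine translate $b+aS=\{b+as : s\in S\}$ of a proper subring $S\subsetneq R$, where $a\in R^{\times}$ and $b\in R$. For integers $n,k\ge 0$ let $\mathcal M_{n,k}$ be the random $n\times k$ matrix with independent entries distributed as $\xi$, and let $\mathcal U_{n,k}$ be the random $n\times k$ matrix with independent entries uniformly distributed on $R$. For an $n\times k$ matrix $M$, $\operatorname{coker}(M)$ is the $R$-module $R^n/M R^k$, considered up to isomorphism, and $\operatorname{span}(M)\subseteq R^n$ is the submodule spanned by the columns of $M$. Write $d_{TV}(X,Y)=\sup_A|\mathbb P(X\in A)-\mathbb P(Y\in A)|$ for the total variation distance between the distributions of $X$ and $Y$. Then: (A) For every $u\in\mathbb Z$ (possibly negative), $d_{TV}\big(\operatorname{coker}(\mathcal M_{n,n+u}),\operatorname{coker}(\mathcal U_{n,n+u})\big)\to 0$ as $n\to\infty$. (B) $d_{TV}\big((\operatorname{coker}(\mathcal M_{n,n}),\det\mathcal M_{n,n}),(\operatorname{coker}(\mathcal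 U_{n,n}),\det\mathcal U_{n,n})\big)\to 0$ as $n\to\infty$. (C) Both (A) and (B) hold with $\operatorname{coker}$ replaced by $\operatorname{span}$. Moreover, let $\|\xi \bmod \mathfrak m\|_2$ and $\|\xi\bmod\mathfrak m\|_\infty$ be the $\ell^2$ and $\ell^\infty$ norms of the distribution of $\xi \bmod \mathfrak m$ on $R/\mathfrak m$ (as a function on $R/\mathfrak m$). If $$\max\Big(\|\xi\bmod\mathfrak m\|_2,\ \|\xi\bmod\mathfrak m\|_\infty,\ \tfrac1{\operatorname{char}(R/\mathfrak m)}\Big)<\theta<1,$$ then in each of the above cases the total variation distance is at most $C\theta^n$ for all $n\ge 0$ (with $n+u\ge 0$ in the cases depending on $u$), where $C$ depends only on $\theta$, $u$, $R$ and the distribution of $\xi$. -/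

import Mathlib

open Filter Topology CategoryTheory

universe v

noncomputable section

namespace RandMat

/-- Total variation distance of two discrete laws: the supremum over all events `A` of
`|P(A) - Q(A)|`. -/
def tvDist {α : Type*} (P Q : PMF α) : ℝ :=
  ⨆ A : Set α, |(P.toOuterMeasure A).toReal - (Q.toOuterMeasure A).toReal|

/-- The `ℓ²` norm of a discrete law. -/
def l2Norm {α : Type*} (P : PMF α) : ℝ := √(∑' a, (P a).toReal ^ 2)

/-- The `ℓ^∞` norm of a discrete law. -/
def lInfNorm {α : Type*} (P : PMF α) : ℝ := ⨆ a, (P a).toReal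

/-- The law of an `n × k` random matrix with independent entries, each with law `ξ`. -/
def iidMatrix {R : Type v} [Fintype R] (ξ : PMF R) (n k : ℕ) : PMF (Matrix (Fin n) (Fin k) R) :=
  PMF.ofFintype (fun M => ∏ i, ∏ j, ξ (M i j)) (by
    have h1 : ∑ a, ξ a = 1 := by rw [← tsum_fintype (L := .unconditional _)]; exact ξ.tsum_coe
    have h2 : ∑ r : Fin k → R, ∏ j, ξ (r j) = 1 := by
      rw [← Fintype.prod_sum (fun (_ : Fin k) a => ξ a)]; simp [h1]
    have h3 := Fintype.prod_sum (fun (_ : Fin n) (r : Fin k → R) => ∏ j, ξ (r j))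
    simp only [h2, Finset.prod_const_one] at h3
    exact h3.symm)

section

variable {R : Type v} [CommRing R]

/-- The law `ξ` is supported on a translate `r + I` of a proper ideal `I`. -/
def ConcentratedOnIdealTranslate (ξ : PMF R) : Prop :=
  ∃ (I : Ideal R) (r : R), I ≠ ⊤ ∧ ∀ x ∈ ξ.support, ∃ y ∈ I, x = r + y

/-- The law `ξ` is supported on an affine translate `b + a S` of a proper subring `S`,
where `a` is a unit. -/
def ConcentratedOnSubringTranslate (ξ : PMF R) : Prop :=
  ∃ (S : Subring R) (a : Rˣ) (b : R), S ≠ ⊤ ∧ ∀ x ∈ ξ.support, ∃ s ∈ S, x = b + a * s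

variable (R) in
/-- Isomorphism classes of `R`-modules. -/
abbrev ModuleClass : Type (v + 1) := Quotient (isIsomorphicSetoid (ModuleCat.{v} R))

/-- The isomorphism class of the cokernel of `M : R^k → R^n`. -/
def cokerClass {n k : ℕ} (M : Matrix (Fin n) (Fin k) R) : ModuleClass R :=
  Quotient.mk _ (ModuleCat.of R ((Fin n → R) ⧸ LinearMap.range M.mulVecLin))

/-- The span of the columns of `M`, a submodule of `R^n`. -/
def colSpan {n k : ℕ} (M : Matrix (Fin n) (Fin k) R) : Submodule R (Fin n → R) :=
  Submodule.span R (Set.range M.col)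

/-- The law of `ξ` modulo the maximal ideal. -/
def modMax [IsLocalRing R] (ξ : PMF R) : PMF (IsLocalRing.ResidueField R) :=
  ξ.map (IsLocalRing.residue R)

variable [Fintype R]

/-- The total variation distance between the laws of `f` at the `n × k` matrix with i.i.d.
entries of law `ξ` and of `f` at the uniform `n × k` matrix. -/
def distToUniform (ξ : PMF R) {n k : ℕ} {β : Type*} (f : Matrix (Fin n) (Fin k) R → β) : ℝ :=
  tvDist ((iidMatrix ξ n k).map f) ((iidMatrix (PMF.uniformOfFintype R) n k).map f)

end

end RandMat

end

/-! Cokernel, column span and determinant do not change when a combination of the other columns is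
added to a column. Exchange the columns one by one for uniform ones (`abs_sum_prod_sub_le`). If the
other columns span `V`, an event is a `V`-invariant function of the remaining column, so only
characters `w` of `R^n` trivial on `V` occur in its Fourier expansion. An exchange thus costs at
most the sum over `w ≠ 0` of `∏ ‖charFun p (w i)‖` times `ρ w ^ (k - 1)`, where `ρ w` bounds the
chance that `w` kills one column.

For this sum, group the `w` by the set `T` of values taken at more than `ε n` coordinates. Up to a
small loss in the base, a group has Fourier mass `(∑ v ∈ T, ‖charFun p v‖) ^ n`. If `T` contains a
nonzero character, a column is killed with probability at most `|K| / |R|` plus an exponentially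
small error, where `K = flatSubgroup p T`; otherwise `killProb_le_critRate` suffices.

The heart is `card_flatSubgroup_mul_sum_le`: mass base times `|K| / |R|` is at most `critRate p`.
The characters in `T` are trivial on the subgroup `Q` generated by `K` times differences of support
points, so their mass is at most `[R : Q] √(collision p Q)`. A unit difference `a` gives `aK ≤ Q`. A
proper inclusion gains a factor of the residue characteristic. If `aK = Q`, the stabilizer of `K` is
a subring with the support in an affine translate, hence is `R`; then `K` is a proper ideal, `Q`
lies in the maximal ideal, and the `ℓ²` norm appears. -/

set_option linter.unusedSectionVars false
set_option linter.unusedDecidableInType false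

namespace RandMat

/-! ### Fourier analysis on `R^ι` and the probability of being killed by a character. -/

section Fourier

variable {R : Type v} [CommRing R] [Fintype R]

/-- The characteristic function of the law with weights `p`. -/
noncomputable def charFun (p : R → ℝ) (ψ : AddChar R ℂ) : ℂ := ∑ x, (p x : ℂ) * ψ x

/-- The weights of the uniform law. -/
noncomputable def unifWeight (R : Type v) [Fintype R] : R → ℝ := fun _ => (Fintype.card R : ℝ)⁻¹

lemma unifWeight_nonneg (x : R) : 0 ≤ unifWeight R x := by
  unfold unifWeight; positivity

lemma sum_unifWeight : ∑ x, unifWeight R x = 1 := by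
  simp [unifWeight]

lemma norm_charFun_le_one {p : R → ℝ} (h0 : ∀ x, 0 ≤ p x) (h1 : ∑ x, p x = 1)
    (ψ : AddChar R ℂ) : ‖charFun p ψ‖ ≤ 1 := by
  refine (norm_sum_le _ _).trans ?_
  rw [← h1]
  refine Finset.sum_le_sum fun x _ => ?_
  simp [ψ.norm_apply, abs_of_nonneg (h0 x)]

lemma charFun_unifWeight [DecidableEq (AddChar R ℂ)] (ψ : AddChar R ℂ) :
    charFun (unifWeight R) ψ = if ψ = 0 then 1 else 0 := by
  have h := ψ.sum_eq_ite
  have hR : (Fintype.card R : ℂ) ≠ 0 := by simp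
  simp only [charFun, unifWeight, ← Finset.mul_sum, h]
  split_ifs <;> simp [hR]

lemma charFun_zero {p : R → ℝ} (h1 : ∑ x, p x = 1) : charFun p 0 = 1 := by
  simp [charFun, ← Complex.ofReal_sum, h1]

variable {ι : Type*} [Fintype ι] [DecidableEq ι]

/-- The character of `R^ι` with components `w i`. -/
noncomputable def tupleChar (w : ι → AddChar R ℂ) (x : ι → R) : ℂ := ∏ i, w i (x i)

lemma tupleChar_add (w : ι → AddChar R ℂ) (x y : ι → R) :
    tupleChar w (x + y) = tupleChar w x * tupleChar w y := by
  simp [tupleChar, AddChar.map_add_eq_mul, Finset.prod_mul_distrib]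

lemma tupleChar_zero_right (w : ι → AddChar R ℂ) : tupleChar w 0 = 1 := by
  simp [tupleChar]

lemma norm_tupleChar (w : ι → AddChar R ℂ) (x : ι → R) : ‖tupleChar w x‖ = 1 := by
  simp [tupleChar, AddChar.norm_apply]

lemma sum_tupleChar [DecidableEq R] (x : ι → R) :
    ∑ w : ι → AddChar R ℂ, tupleChar w x =
      if x = 0 then (Fintype.card R : ℂ) ^ Fintype.card ι else 0 := by
  have h : ∑ w : ι → AddChar R ℂ, tupleChar w x = ∏ i, ∑ ψ : AddChar R ℂ, ψ (x i) :=
    (Fintype.prod_sum fun i (ψ : AddChar R ℂ) => ψ (x i)).symm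
  rw [h]
  simp only [AddChar.sum_apply_eq_ite]
  split_ifs with hx
  · simp [hx]
  · obtain ⟨i, hi⟩ := Function.ne_iff.mp hx
    exact Finset.prod_eq_zero (Finset.mem_univ i) (if_neg hi)

lemma sum_prod_mul_tupleChar (p : R → ℝ) (w : ι → AddChar R ℂ) :
    ∑ x : ι → R, ((∏ i, p (x i) : ℝ) : ℂ) * tupleChar w x = ∏ i, charFun p (w i) := by
  simp only [charFun, Fintype.prod_sum, tupleChar, Complex.ofReal_prod, Finset.prod_mul_distrib]

/-- The Fourier coefficient of `h` at `w`. -/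
noncomputable def fourierCoeff (h : (ι → R) → ℝ) (w : ι → AddChar R ℂ) : ℂ :=
  ((Fintype.card R : ℂ) ^ Fintype.card ι)⁻¹ * ∑ y, (h y : ℂ) * tupleChar w (-y)

lemma fourier_inversion (h : (ι → R) → ℝ) (x : ι → R) :
    (h x : ℂ) = ∑ w, fourierCoeff h w * tupleChar w x := by
  classical
  have hR : (Fintype.card R : ℂ) ^ Fintype.card ι ≠ 0 := by simp
  simp only [fourierCoeff, mul_assoc, ← Finset.mul_sum]
  rw [eq_inv_mul_iff_mul_eq₀ hR]
  simp only [Finset.sum_mul]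
  rw [Finset.sum_comm]
  have : ∀ y, ∑ w : ι → AddChar R ℂ, (h y : ℂ) * tupleChar w (-y) * tupleChar w x =
      (h y : ℂ) * if x = y then (Fintype.card R : ℂ) ^ Fintype.card ι else 0 := by
    intro y
    have h2 := sum_tupleChar (-y + x)
    simp only [tupleChar_add] at h2
    simp only [mul_assoc, ← Finset.mul_sum, h2, neg_add_eq_zero, eq_comm]
  rw [Finset.sum_congr rfl fun y _ => this y]
  simp [mul_comm]

lemma norm_fourierCoeff_le {h : (ι → R) → ℝ} (hh : ∀ x, |h x| ≤ 1) (w : ι → AddChar R ℂ) :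
    ‖fourierCoeff h w‖ ≤ 1 := by
  classical
  have hR : (0 : ℝ) < (Fintype.card R : ℝ) ^ Fintype.card ι := by
    have : 0 < Fintype.card R := Fintype.card_pos
    positivity
  rw [fourierCoeff, norm_mul, norm_inv, norm_pow, Complex.norm_natCast, inv_mul_le_iff₀ hR, mul_one]
  refine (norm_sum_le _ _).trans ?_
  refine (Finset.sum_le_sum (g := fun _ => (1 : ℝ)) fun y _ => ?_).trans ?_
  · simpa [norm_tupleChar] using hh y
  · simp

/-- Translating the summation variable by `v` multiplies the sum by `tupleChar w v`. -/
lemma fourierCoeff_eq_zero {h : (ι → R) → ℝ} {v : ι → R} (hv : ∀ x, h (x + v) = h x)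
    {w : ι → AddChar R ℂ} (hw : tupleChar w v ≠ 1) : fourierCoeff h w = 0 := by
  classical
  have key : ∑ y, (h y : ℂ) * tupleChar w (-y) =
      tupleChar w v * ∑ y, (h y : ℂ) * tupleChar w (-y) := by
    rw [Finset.mul_sum, ← Equiv.sum_comp (Equiv.addRight v)
      (fun y => tupleChar w v * ((h y : ℂ) * tupleChar w (-y)))]
    refine Finset.sum_congr rfl fun y _ => ?_
    have : tupleChar w (-y) = tupleChar w v * tupleChar w (-(y + v)) := by
      rw [← tupleChar_add]; congr 1; abel
    simp only [Equiv.coe_addRight, hv]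
    rw [this]; ring
  have : (1 - tupleChar w v) * ∑ y, (h y : ℂ) * tupleChar w (-y) = 0 := by
    rw [sub_mul, one_mul, ← key, sub_self]
  rcases mul_eq_zero.mp this with h0 | h0
  · exact absurd (sub_eq_zero.mp h0).symm hw
  · simp [fourierCoeff, h0]

open Classical in
/-- A bounded function that is invariant under a submodule `V` has nearly the same mean under a
product law as under the uniform law, up to the Fourier mass of the characters killing `V`. -/
lemma abs_sum_sub_uniform_le {p : R → ℝ} (h1 : ∑ x, p x = 1)
    (V : Submodule R (ι → R)) {h : (ι → R) → ℝ} (hh : ∀ x, |h x| ≤ 1)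
    (hV : ∀ x, ∀ v ∈ V, h (x + v) = h x) :
    |∑ x : ι → R, (∏ i, p (x i) - ∏ i, unifWeight R (x i)) * h x| ≤
      ∑ w : ι → AddChar R ℂ with w ≠ 0,
        if ∀ v ∈ V, tupleChar w v = 1 then ∏ i, ‖charFun p (w i)‖ else 0 := by
  have e : ((∑ x : ι → R, (∏ i, p (x i) - ∏ i, unifWeight R (x i)) * h x : ℝ) : ℂ) =
      ∑ w, fourierCoeff h w *
        (∏ i, charFun p (w i) - ∏ i, charFun (unifWeight R) (w i)) := by
    simp only [← sum_prod_mul_tupleChar, ← Finset.sum_sub_distrib, Finset.mul_sum]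
    rw [Finset.sum_comm]
    push_cast
    refine Finset.sum_congr rfl fun x _ => ?_
    rw [fourier_inversion h x, Finset.mul_sum]
    refine Finset.sum_congr rfl fun w _ => ?_
    ring
  rw [← Real.norm_eq_abs, ← Complex.norm_real, e, Finset.sum_filter]
  refine (norm_sum_le _ _).trans (Finset.sum_le_sum fun w _ => ?_)
  split_ifs with hw hk
  · have hz : ∏ i, charFun (unifWeight R) (w i) = 0 := by
      obtain ⟨i, hi⟩ := Function.ne_iff.mp hw
      refine Finset.prod_eq_zero (Finset.mem_univ i) ?_
      rw [charFun_unifWeight]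
      exact if_neg hi
    rw [hz, sub_zero, norm_mul, norm_prod]
    exact mul_le_of_le_one_left (by positivity) (norm_fourierCoeff_le hh w)
  · push Not at hk
    obtain ⟨v, hv, hvw⟩ := hk
    simp [fourierCoeff_eq_zero (fun x => hV x v hv) hvw]
  · push Not at hw
    simp [hw, charFun_zero h1, charFun_zero (sum_unifWeight (R := R))]

/-- The character `w` is trivial on the submodule generated by `x`. -/
def Kills (w : ι → AddChar R ℂ) (x : ι → R) : Prop := ∀ r : R, tupleChar w (r • x) = 1

open Classical in
/-- The probability that `w` is trivial on the submodule generated by a random vector with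
independent entries of weights `p`. -/
noncomputable def killProb (p : R → ℝ) (w : ι → AddChar R ℂ) : ℝ :=
  ∑ x : ι → R, (∏ i, p (x i)) * if Kills w x then 1 else 0

lemma killProb_nonneg {p : R → ℝ} (h0 : ∀ x, 0 ≤ p x) (w : ι → AddChar R ℂ) :
    0 ≤ killProb p w := by
  classical
  exact Finset.sum_nonneg fun x _ =>
    mul_nonneg (Finset.prod_nonneg fun i _ => h0 _) (by split_ifs <;> simp)

/-- For fixed `x`, `r ↦ tupleChar w (r • x)` is an additive character of `R`; its average over `r`
is the indicator of `Kills w x`. -/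
lemma killProb_eq (p : R → ℝ) (w : ι → AddChar R ℂ) :
    (killProb p w : ℂ) =
      (Fintype.card R : ℂ)⁻¹ * ∑ r : R, ∏ i, charFun p ((w i).mulShift r) := by
  classical
  have hR : (Fintype.card R : ℂ) ≠ 0 := by simp
  have hk : ∀ x : ι → R, ∑ r : R, tupleChar w (r • x) =
      (Fintype.card R : ℂ) * if Kills w x then 1 else 0 := by
    intro x
    let ψ : AddChar R ℂ :=
      { toFun := fun r => tupleChar w (r • x)
        map_zero_eq_one' := by simp [tupleChar_zero_right]
        map_add_eq_mul' := fun a b => by simp [add_smul, tupleChar_add] }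
    have h := ψ.sum_eq_ite
    have e : ψ = 0 ↔ Kills w x := by
      rw [DFunLike.ext_iff]; rfl
    simp only [e] at h
    rw [mul_ite, mul_one, mul_zero]
    exact h
  rw [eq_inv_mul_iff_mul_eq₀ hR]
  have hs : ∀ (r : R) (x : ι → R),
      tupleChar (fun i => (w i).mulShift r) x = tupleChar w (r • x) := fun r x => rfl
  simp only [← sum_prod_mul_tupleChar, hs]
  rw [Finset.sum_comm]
  simp only [← Finset.mul_sum, hk, killProb]
  push_cast
  rw [Finset.mul_sum]
  refine Finset.sum_congr rfl fun x _ => ?_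
  split_ifs <;> simp [mul_comm]

lemma killProb_le {p : R → ℝ} (h0 : ∀ x, 0 ≤ p x) (w : ι → AddChar R ℂ) :
    killProb p w ≤
      (Fintype.card R : ℝ)⁻¹ * ∑ r : R, ∏ i, ‖charFun p ((w i).mulShift r)‖ := by
  have h : ‖(killProb p w : ℂ)‖ = killProb p w := by
    rw [Complex.norm_real, Real.norm_of_nonneg (killProb_nonneg h0 w)]
  rw [← h, killProb_eq, norm_mul, norm_inv, Complex.norm_natCast]
  refine mul_le_mul_of_nonneg_left ((norm_sum_le _ _).trans_eq ?_) (by positivity)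
  simp [norm_prod]

end Fourier

/-! ### Exchange of columns. -/

section Lindeberg

variable {R : Type v} [CommRing R] [Fintype R] {ι : Type*} [Fintype ι] [DecidableEq ι]

/-- Columns `0, …, j - 1` have weights `P` and the others have weights `Q`. -/
def hybrid {X : Type*} (P Q : X → ℝ) (j : ℕ) {k : ℕ} (i : Fin k) : X → ℝ :=
  if (i : ℕ) < j then P else Q

lemma hybrid_succ_sub {X : Type*} (P Q : X → ℝ) {m : ℕ} (j : Fin (m + 1)) (c : Fin (m + 1) → X) :
    ∏ i, hybrid P Q (j + 1) i (c i) - ∏ i, hybrid P Q j i (c i) =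
      (P (c j) - Q (c j)) * ∏ i, hybrid P Q j (j.succAbove i) (c (j.succAbove i)) := by
  rw [Fin.prod_univ_succAbove _ j, Fin.prod_univ_succAbove _ j]
  have : ∀ i : Fin m, hybrid P Q (j + 1) (j.succAbove i) = hybrid P Q j (j.succAbove i) := by
    intro i
    have hne : ((j.succAbove i : Fin (m + 1)) : ℕ) ≠ j := fun h =>
      Fin.succAbove_ne j i (Fin.ext h)
    unfold hybrid
    congr 1
    rw [eq_iff_iff]; omega
  simp only [this]
  simp [hybrid]; ring

open Classical in
/-- Replacing the columns of a random matrix one at a time: a bounded function of the columns that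
is invariant under adding to a column a combination of the others has nearly the same mean for
independent columns with weights `p` as for uniform columns. -/
lemma abs_sum_prod_sub_le {p : R → ℝ} (h0 : ∀ x, 0 ≤ p x) (h1 : ∑ x, p x = 1)
    {k : ℕ} {g : (Fin k → ι → R) → ℝ} (hg : ∀ c, |g c| ≤ 1)
    (hinv : ∀ c j, ∀ y ∈ Submodule.span R (Set.image c {j}ᶜ), g (Function.update c j (c j + y)) = g c)
    {ρ : (ι → AddChar R ℂ) → ℝ} (hρ : ∀ w, w ≠ 0 → killProb p w ≤ ρ w)
    (hρ' : ∀ w, w ≠ 0 → killProb (unifWeight R) w ≤ ρ w) :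
    |∑ c : Fin k → ι → R, (∏ j, ∏ i, p (c j i) - ∏ j, ∏ i, unifWeight R (c j i)) * g c| ≤
      k * ∑ w : ι → AddChar R ℂ with w ≠ 0, (∏ i, ‖charFun p (w i)‖) * ρ w ^ (k - 1) := by
  classical
  set P : (ι → R) → ℝ := fun x => ∏ i, p (x i)
  set U : (ι → R) → ℝ := fun x => ∏ i, unifWeight R (x i)
  obtain _ | m := k
  · simp
  have hyb0 : ∀ j (i : Fin (m + 1)) x, 0 ≤ hybrid P U j i x := by
    intro j i x
    unfold hybrid
    split_ifs
    · exact Finset.prod_nonneg fun i _ => h0 _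
    · exact Finset.prod_nonneg fun i _ => unifWeight_nonneg _
  have tele : ∀ c : Fin (m + 1) → ι → R, ∏ j, P (c j) - ∏ j, U (c j) =
      ∑ j : Fin (m + 1),
        (P (c j) - U (c j)) * ∏ i, hybrid P U j (j.succAbove i) (c (j.succAbove i)) := by
    intro c
    simp only [← hybrid_succ_sub]
    rw [Fin.sum_univ_eq_sum_range
      (fun j => ∏ i, hybrid P U (j + 1) i (c i) - ∏ i, hybrid P U j i (c i)),
      Finset.sum_range_sub (fun j => ∏ i, hybrid P U j i (c i))]
    simp only [hybrid, Fin.is_lt, if_true, Nat.not_lt_zero, if_false]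
  have step : ∀ j : Fin (m + 1), |∑ c : Fin (m + 1) → ι → R,
      ((P (c j) - U (c j)) * ∏ i, hybrid P U j (j.succAbove i) (c (j.succAbove i))) * g c| ≤
      ∑ w : ι → AddChar R ℂ with w ≠ 0, (∏ i, ‖charFun p (w i)‖) * ρ w ^ m := by
    intro j
    rw [← (Fin.insertNthEquiv (fun _ => ι → R) j).sum_comp, Fintype.sum_prod_type,
      Finset.sum_comm]
    simp only [Fin.insertNthEquiv_apply, Fin.insertNth_apply_same, Fin.insertNth_apply_succAbove]
    have col : ∀ c' : Fin m → ι → R,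
        |∑ x, (P x - U x) * g (j.insertNth (α := fun _ => ι → R) x c')| ≤
        ∑ w : ι → AddChar R ℂ with w ≠ 0,
          (∏ i, ‖charFun p (w i)‖) * ∏ l, if Kills w (c' l) then 1 else 0 := by
      intro c'
      -- With the other columns `c'` fixed, `g` is invariant under their span, so only the `w`
      -- killing all of them survive.
      refine (abs_sum_sub_uniform_le h1 (Submodule.span R (Set.range c'))
        (fun x => hg _) ?_).trans ?_
      · intro x v hv
        have := hinv (j.insertNth (α := fun _ => ι → R) x c') j v ?_
        · rwa [Fin.insertNth_apply_same, Fin.update_insertNth] at this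
        · refine Submodule.span_mono ?_ hv
          rintro _ ⟨l, rfl⟩
          exact ⟨j.succAbove l, Fin.succAbove_ne j l, Fin.insertNth_apply_succAbove ..⟩
      · refine Finset.sum_le_sum fun w _ => ?_
        split_ifs with hw
        · have hk : ∏ l, (if Kills w (c' l) then (1 : ℝ) else 0) = 1 := by
            refine Finset.prod_eq_one fun l _ => if_pos ?_
            exact fun r => hw _ (Submodule.smul_mem _ _ (Submodule.subset_span ⟨l, rfl⟩))
          rw [hk, mul_one]
        · exact mul_nonneg (by positivity)
            (Finset.prod_nonneg fun l _ => by split_ifs <;> simp)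
    have e : ∀ c' : Fin m → ι → R, ∑ x, (P x - U x) * (∏ i, hybrid P U j (j.succAbove i) (c' i)) *
        g (Fin.insertNthEquiv (fun _ => ι → R) j (x, c')) =
        (∏ i, hybrid P U j (j.succAbove i) (c' i)) *
          ∑ x, (P x - U x) * g (j.insertNth (α := fun _ => ι → R) x c') := by
      intro c'
      rw [Finset.mul_sum]
      refine Finset.sum_congr rfl fun x _ => ?_
      change _ * g (j.insertNth (α := fun _ => ι → R) x c') = _
      ring
    rw [Finset.sum_congr rfl fun c' _ => e c']
    refine (Finset.abs_sum_le_sum_abs _ _).trans ?_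
    refine (Finset.sum_le_sum (g := fun c' : Fin m → ι → R =>
      ∑ w : ι → AddChar R ℂ with w ≠ 0, (∏ i, ‖charFun p (w i)‖) *
        ∏ l, (hybrid P U j (j.succAbove l) (c' l) * if Kills w (c' l) then 1 else 0))
      fun c' _ => ?_).trans ?_
    · have hn : 0 ≤ ∏ i, hybrid P U j (j.succAbove i) (c' i) :=
        Finset.prod_nonneg fun i _ => hyb0 _ _ _
      rw [abs_mul, abs_of_nonneg hn]
      refine (mul_le_mul_of_nonneg_left (col c') hn).trans_eq ?_
      rw [Finset.mul_sum]
      refine Finset.sum_congr rfl fun w _ => ?_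
      rw [Finset.prod_mul_distrib]; ring
    · rw [Finset.sum_comm]
      refine Finset.sum_le_sum fun w hw => ?_
      have hw : w ≠ 0 := (Finset.mem_filter.mp hw).2
      rw [← Finset.mul_sum]
      refine mul_le_mul_of_nonneg_left ?_ (by positivity)
      -- The other columns are independent: the sum over `c'` factors into kill probabilities, for
      -- `p` or for the uniform weights.
      rw [← Fintype.prod_sum fun (l : Fin m) (x : ι → R) =>
        hybrid P U j (j.succAbove l) x * if Kills w x then 1 else 0]
      refine (Finset.prod_le_prod (g := fun _ => ρ w) (fun l _ => Finset.sum_nonneg fun x _ =>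
        mul_nonneg (hyb0 _ _ _) (by split_ifs <;> simp)) fun l _ => ?_).trans_eq (by simp)
      unfold hybrid
      split_ifs
      · exact hρ w hw
      · exact hρ' w hw
  change |∑ c, (∏ j, P (c j) - ∏ j, U (c j)) * g c| ≤ _
  simp only [tele, Finset.sum_mul]
  rw [Finset.sum_comm]
  refine (Finset.abs_sum_le_sum_abs _ _).trans ?_
  refine (Finset.sum_le_sum fun j _ => step j).trans_eq ?_
  simp

end Lindeberg

/-! ### Mean size of characteristic functions via collision probabilities. -/

section Collision

variable {R : Type v} [CommRing R] [Fintype R]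

open Classical in
/-- The probability that two independent elements with weights `p` differ by an element of `A`. -/
noncomputable def collision (p : R → ℝ) (A : Set R) : ℝ :=
  ∑ x, ∑ y, p x * p y * if x - y ∈ A then 1 else 0

lemma collision_mono {p : R → ℝ} (h0 : ∀ x, 0 ≤ p x) {A B : Set R} (h : A ⊆ B) :
    collision p A ≤ collision p B := by
  classical
  refine Finset.sum_le_sum fun x _ => Finset.sum_le_sum fun y _ =>
    mul_le_mul_of_nonneg_left ?_ (mul_nonneg (h0 x) (h0 y))
  by_cases hA : x - y ∈ A
  · rw [if_pos hA, if_pos (h hA)]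
  · rw [if_neg hA]; split_ifs <;> simp

lemma collision_univ {p : R → ℝ} (h1 : ∑ x, p x = 1) : collision p Set.univ = 1 := by
  simp [collision, ← Finset.mul_sum, h1]

lemma norm_charFun_sq (p : R → ℝ) (ψ : AddChar R ℂ) :
    ((‖charFun p ψ‖ ^ 2 : ℝ) : ℂ) = ∑ x, ∑ y, (p x : ℂ) * p y * ψ (x - y) := by
  rw [Complex.ofReal_pow, ← Complex.mul_conj', charFun, map_sum, Finset.sum_mul_sum]
  refine Finset.sum_congr rfl fun x _ => Finset.sum_congr rfl fun y _ => ?_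
  rw [sub_eq_add_neg, AddChar.map_add_eq_mul, AddChar.map_neg_eq_conj, map_mul,
    Complex.conj_ofReal]
  ring

/-- The squared norm is the mean of `Re ψ (a - b)` over two independent samples; no value exceeds
`1`, and the pair `x, y` gives less. -/
lemma norm_charFun_lt_one {p : R → ℝ} (h0 : ∀ x, 0 ≤ p x) (h1 : ∑ x, p x = 1)
    {ψ : AddChar R ℂ} {x y : R} (hx : p x ≠ 0) (hy : p y ≠ 0) (hxy : ψ (x - y) ≠ 1) :
    ‖charFun p ψ‖ < 1 := by
  have hre : ∀ z : R, (ψ z).re ≤ 1 := fun z =>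
    (Complex.re_le_norm _).trans_eq (ψ.norm_apply z)
  have hlt : (ψ (x - y)).re < 1 := by
    refine lt_of_le_of_ne (hre _) fun h => hxy ?_
    have h2 := Complex.sq_norm (ψ (x - y))
    rw [ψ.norm_apply, Complex.normSq_apply, h] at h2
    have him : (ψ (x - y)).im = 0 := by
      have : (ψ (x - y)).im * (ψ (x - y)).im = 0 := by linarith
      simpa using this
    exact Complex.ext (by simpa using h) (by simpa using him)
  have e : ‖charFun p ψ‖ ^ 2 = ∑ a, ∑ b, p a * p b * (ψ (a - b)).re := by
    have := congrArg Complex.re (norm_charFun_sq p ψ)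
    rw [Complex.ofReal_re] at this
    rw [this]
    simp only [Complex.re_sum, ← Complex.ofReal_mul, Complex.re_ofReal_mul]
  have hle : ∀ a b, p a * p b * (ψ (a - b)).re ≤ p a * p b := fun a b =>
    mul_le_of_le_one_right (mul_nonneg (h0 a) (h0 b)) (hre _)
  have hs : ‖charFun p ψ‖ ^ 2 < ∑ a, ∑ b, p a * p b := by
    rw [e]
    refine Finset.sum_lt_sum (fun a _ => Finset.sum_le_sum fun b _ => hle a b)
      ⟨x, Finset.mem_univ x, Finset.sum_lt_sum (fun b _ => hle x b) ⟨y, Finset.mem_univ y, ?_⟩⟩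
    have hpos : 0 < p x * p y :=
      mul_pos (lt_of_le_of_ne (h0 x) hx.symm) (lt_of_le_of_ne (h0 y) hy.symm)
    exact mul_lt_of_lt_one_right hpos hlt
  have : ∑ a, ∑ b, p a * p b = 1 := by simp [← Finset.mul_sum, h1]
  rw [this] at hs
  exact (sq_lt_one_iff₀ (norm_nonneg _)).mp hs

open Classical in
/-- The mean of `‖charFun p ·‖` over a family of characters that detects the set `A`. -/
lemma sum_norm_charFun_le {p : R → ℝ} {κ : Type*} [Fintype κ]
    (f : κ → AddChar R ℂ) (A : Set R)
    (hA : ∀ x, ∑ k, f k x = if x ∈ A then (Fintype.card κ : ℂ) else 0) :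
    ∑ k, ‖charFun p (f k)‖ ≤ Fintype.card κ * √(collision p A) := by
  have e : ∑ k, ‖charFun p (f k)‖ ^ 2 = Fintype.card κ * collision p A := by
    have : ((∑ k, ‖charFun p (f k)‖ ^ 2 : ℝ) : ℂ) = ((Fintype.card κ * collision p A : ℝ) : ℂ) := by
      rw [Complex.ofReal_sum]
      simp only [norm_charFun_sq]
      rw [Finset.sum_comm, collision]
      push_cast
      rw [Finset.mul_sum]
      refine Finset.sum_congr rfl fun x _ => ?_
      rw [Finset.sum_comm, Finset.mul_sum]
      refine Finset.sum_congr rfl fun y _ => ?_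
      rw [← Finset.mul_sum, hA]
      split_ifs <;> simp; ring
    exact_mod_cast this
  -- Cauchy–Schwarz passes from the second moment to the first, whence the square root.
  have hcs := sq_sum_le_card_mul_sum_sq (s := Finset.univ) (f := fun k => ‖charFun p (f k)‖)
  rw [e, Finset.card_univ, ← mul_assoc, ← sq] at hcs
  have := Real.le_sqrt_of_sq_le hcs
  rwa [Real.sqrt_mul (by positivity), Real.sqrt_sq (by positivity)] at this

/-- The characters of `R` that are trivial on a subgroup `Q`. -/
lemma sum_norm_charFun_le_of_trivial {p : R → ℝ} (Q : AddSubgroup R) (T : Finset (AddChar R ℂ))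
    (hT : ∀ v ∈ T, ∀ x ∈ Q, v x = 1) :
    ∑ v ∈ T, ‖charFun p v‖ ≤ Nat.card (R ⧸ Q) * √(collision p (Q : Set R)) := by
  classical
  have := Fintype.ofFinite (R ⧸ Q)
  let f : AddChar (R ⧸ Q) ℂ → AddChar R ℂ := fun χ => χ.compAddMonoidHom (QuotientAddGroup.mk' Q)
  have hf : ∀ χ x, f χ x = χ (x : R ⧸ Q) := fun χ x => rfl
  have h := sum_norm_charFun_le (p := p) f (Q : Set R) (fun x => by
    simp only [hf, AddChar.sum_apply_eq_ite, AddChar.card_eq, QuotientAddGroup.eq_zero_iff,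
      SetLike.mem_coe])
  rw [AddChar.card_eq, ← Nat.card_eq_fintype_card] at h
  refine le_trans ?_ h
  have hinj : Function.Injective f := by
    intro χ χ' hχ
    ext x
    obtain ⟨x, rfl⟩ := QuotientAddGroup.mk_surjective x
    rw [← hf, ← hf, hχ]
  rw [← Finset.sum_image (s := Finset.univ) (g := f) (f := fun v => ‖charFun p v‖)
    (fun _ _ _ _ h => hinj h)]
  refine Finset.sum_le_sum_of_subset_of_nonneg (fun v hv => ?_) fun _ _ _ => norm_nonneg _
  rw [Finset.mem_image]
  let g : R ⧸ Q →+ Additive ℂ := QuotientAddGroup.lift Q v.toAddMonoidHom (fun x hx => by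
    have := hT v hv x hx
    exact this)
  refine ⟨AddChar.toAddMonoidHomEquiv.symm g, Finset.mem_univ _, ?_⟩
  ext x
  rfl

/-- The characters `x ↦ ψ (r x)`. -/
lemma sum_norm_charFun_mulShift_le {p : R → ℝ} (h0 : ∀ x, 0 ≤ p x) [IsLocalRing R]
    {ψ : AddChar R ℂ} (hψ : ψ ≠ 0) :
    ∑ r : R, ‖charFun p (ψ.mulShift r)‖ ≤
      Fintype.card R * √(collision p (IsLocalRing.maximalIdeal R : Set R)) := by
  classical
  let A : Set R := {x | ψ.mulShift x = 0}
  have h := sum_norm_charFun_le (p := p) (fun r => ψ.mulShift r) A (fun x => by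
    refine Eq.trans ?_ (AddChar.sum_eq_ite (ψ.mulShift x))
    exact Finset.sum_congr rfl fun r _ => by simp [mul_comm])
  refine h.trans (mul_le_mul_of_nonneg_left (Real.sqrt_le_sqrt (collision_mono h0 ?_))
    (by positivity))
  intro x hx
  rw [SetLike.mem_coe, IsLocalRing.mem_maximalIdeal, mem_nonunits_iff]
  intro hu
  exact hψ ((ψ.mulShift_unit_eq_one_iff hu).mp hx)

end Collision

/-! ### Indices of additive subgroups. -/

section Subgroups

variable {R : Type v} [CommRing R] [IsLocalRing R] [Fintype R]

lemma prime_ringChar_residueField : (ringChar (IsLocalRing.ResidueField R)).Prime :=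
  haveI : Finite (IsLocalRing.ResidueField R) :=
    Finite.of_surjective _ (IsLocalRing.residue_surjective (R := R))
  CharP.prime_ringChar _

/-- The residue characteristic `q` is nilpotent in `R`, so `R` is an additive `q`-group and a
nontrivial index is at least `q`. -/
lemma ringChar_mul_card_le {A B : AddSubgroup R} (h : A < B) :
    ringChar (IsLocalRing.ResidueField R) * Nat.card A ≤ Nat.card B := by
  set q := ringChar (IsLocalRing.ResidueField R) with hq
  have hqp : q.Prime := prime_ringChar_residueField
  have hnil : IsNilpotent (q : R) := by
    have hm : (q : R) ∈ IsLocalRing.maximalIdeal R := by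
      rw [← IsLocalRing.residue_eq_zero_iff, map_natCast]
      exact ringChar.Nat.cast_ringChar
    obtain ⟨n, hn⟩ := IsArtinianRing.isNilpotent_jacobson_bot (R := R)
    rw [IsLocalRing.jacobson_eq_maximalIdeal ⊥ bot_ne_top] at hn
    refine ⟨n, ?_⟩
    have := Ideal.pow_mem_pow hm n
    rwa [hn] at this
  obtain ⟨e, he⟩ := hnil
  have hprime : ∀ l : ℕ, l.Prime → l ∣ Nat.card R → l = q := by
    intro l hl hdvd
    have := Fact.mk hl
    rw [Nat.card_eq_fintype_card] at hdvd
    obtain ⟨x, hx⟩ := exists_prime_addOrderOf_dvd_card l hdvd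
    have : l ∣ q ^ e := by
      rw [← hx, addOrderOf_dvd_iff_nsmul_eq_zero, nsmul_eq_mul]
      push_cast
      rw [he, zero_mul]
    exact (Nat.prime_dvd_prime_iff_eq hl hqp).mp (hl.dvd_of_dvd_pow this)
  have hcard : A.relIndex B * Nat.card A = Nat.card B := by
    have := AddSubgroup.relIndex_mul_relIndex ⊥ A B bot_le h.le
    rwa [AddSubgroup.relIndex_bot_left, AddSubgroup.relIndex_bot_left, mul_comm] at this
  rw [← hcard]
  refine Nat.mul_le_mul_right _ ?_
  have hne : A.relIndex B ≠ 1 := fun h1 => h.not_ge (AddSubgroup.relIndex_eq_one.mp h1)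
  have hdvd : A.relIndex B ∣ Nat.card R :=
    (Dvd.intro _ hcard).trans (AddSubgroup.card_addSubgroup_dvd_card B)
  have := hprime _ (Nat.minFac_prime hne) ((Nat.minFac_dvd _).trans hdvd)
  rw [← this]
  refine Nat.minFac_le (Nat.pos_of_ne_zero fun h0 => ?_)
  rw [h0, zero_mul] at hcard
  exact Nat.card_pos.ne hcard

end Subgroups

/-! ### The flat subgroup and the critical rate. -/

section Structure

variable {R : Type v} [CommRing R] [Fintype R]

/-- Weights of a law that is supported neither on a translate of the nonunits nor on an affine
translate of a proper subring. -/
structure IsSpread (p : R → ℝ) : Prop where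
  nonneg : ∀ x, 0 ≤ p x
  sum_eq_one : ∑ x, p x = 1
  exists_isUnit_sub : ∃ x y, p x ≠ 0 ∧ p y ≠ 0 ∧ IsUnit (x - y)
  eq_top_of_subring : ∀ (S : Subring R) (a : Rˣ) (b : R),
    (∀ x, p x ≠ 0 → ∃ s ∈ S, x = b + a * s) → S = ⊤

/-- The elements `r` for which all characters `x ↦ v (r x)`, `v ∈ T`, are constant on the support
of `p`. -/
def flatSubgroup (p : R → ℝ) (T : Finset (AddChar R ℂ)) : AddSubgroup R where
  carrier := {r | ∀ v ∈ T, ∀ x y, p x ≠ 0 → p y ≠ 0 → v (r * (x - y)) = 1}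
  zero_mem' := fun v _ x y _ _ => by simp
  add_mem' := fun {r s} hr hs v hv x y hx hy => by
    rw [add_mul, AddChar.map_add_eq_mul, hr v hv x y hx hy, hs v hv x y hx hy, one_mul]
  neg_mem' := fun {r} hr v hv x y hx hy => by
    rw [neg_mul, AddChar.map_neg_eq_inv, hr v hv x y hx hy, inv_one]

lemma mem_flatSubgroup {p : R → ℝ} {T : Finset (AddChar R ℂ)} {r : R} :
    r ∈ flatSubgroup p T ↔ ∀ v ∈ T, ∀ x y, p x ≠ 0 → p y ≠ 0 → v (r * (x - y)) = 1 := Iff.rfl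

lemma flatSubgroup_ne_top {p : R → ℝ} (hp : IsSpread p) {T : Finset (AddChar R ℂ)}
    (hT : ∃ v ∈ T, v ≠ 0) : flatSubgroup p T ≠ ⊤ := by
  obtain ⟨v, hv, hv0⟩ := hT
  obtain ⟨x, y, hx, hy, hu⟩ := hp.exists_isUnit_sub
  intro h
  apply hv0
  ext z
  have hz : z * (hu.unit⁻¹ : Rˣ) ∈ flatSubgroup p T := h ▸ AddSubgroup.mem_top _
  have := hz v hv x y hx hy
  rwa [mul_assoc, IsUnit.val_inv_mul, mul_one] at this

variable [IsLocalRing R]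

/-- The critical rate: the larger of the `ℓ²` norm modulo the maximal ideal and `1 / p`, where `p`
is the residue characteristic. -/
noncomputable def critRate (p : R → ℝ) : ℝ :=
  max √(collision p (IsLocalRing.maximalIdeal R : Set R))
    (1 / (ringChar (IsLocalRing.ResidueField R) : ℝ))

lemma critRate_pos (p : R → ℝ) : 0 < critRate p := by
  refine lt_max_of_lt_right ?_
  have := (prime_ringChar_residueField (R := R)).pos
  positivity

lemma card_div_card_le {A B : AddSubgroup R} (h : A < B) :
    (Nat.card A : ℝ) / Nat.card B ≤ 1 / (ringChar (IsLocalRing.ResidueField R) : ℝ) := by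
  have hq := (prime_ringChar_residueField (R := R)).pos
  have hB : 0 < Nat.card B := Nat.card_pos
  rw [div_le_div_iff₀ (by positivity) (by positivity), one_mul, mul_comm]
  exact_mod_cast ringChar_mul_card_le h

lemma inv_card_le_critRate (p : R → ℝ) : (Fintype.card R : ℝ)⁻¹ ≤ critRate p := by
  have hq := (prime_ringChar_residueField (R := R)).pos
  have h := ringChar_mul_card_le (bot_lt_top (α := AddSubgroup R))
  rw [Nat.card_congr AddSubgroup.topEquiv.toEquiv, Nat.card_eq_fintype_card (α := R),
    AddSubgroup.card_bot, mul_one] at h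
  rw [inv_eq_one_div]
  refine le_max_of_le_right (one_div_le_one_div_of_le (by exact_mod_cast hq) ?_)
  exact_mod_cast h

/-- The Fourier mass of a set `T` of characters, compared with its flat subgroup. -/
lemma card_flatSubgroup_mul_sum_le {p : R → ℝ} (hp : IsSpread p) {T : Finset (AddChar R ℂ)}
    (hT : ∃ v ∈ T, v ≠ 0) :
    (Nat.card (flatSubgroup p T) : ℝ) / Fintype.card R * ∑ v ∈ T, ‖charFun p v‖ ≤ critRate p := by
  set K := flatSubgroup p T with hK
  obtain ⟨x₀, y₀, hx₀, hy₀, hu⟩ := hp.exists_isUnit_sub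
  obtain ⟨a, ha⟩ := hu
  let Q : AddSubgroup R := AddSubgroup.closure
    {z | ∃ r ∈ K, ∃ x y, p x ≠ 0 ∧ p y ≠ 0 ∧ r * (x - y) = z}
  have hQ : ∀ r ∈ K, ∀ x y, p x ≠ 0 → p y ≠ 0 → r * (x - y) ∈ Q := fun r hr x y hx hy =>
    AddSubgroup.subset_closure ⟨r, hr, x, y, hx, hy, rfl⟩
  have hTQ : ∀ v ∈ T, ∀ x ∈ Q, v x = 1 := by
    intro v hv x hx
    induction hx using AddSubgroup.closure_induction with
    | mem z hz =>
      obtain ⟨r, hr, x, y, hx, hy, rfl⟩ := hz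
      exact hr v hv x y hx hy
    | zero => simp
    | add x y _ _ h1 h2 => rw [AddChar.map_add_eq_mul, h1, h2, one_mul]
    | neg x _ h1 => rw [AddChar.map_neg_eq_inv, h1, inv_one]
  have hsum := sum_norm_charFun_le_of_trivial (p := p) Q T hTQ
  -- Since `aK ≤ Q` and `a` is a unit, `|K| / |R|` times `[R : Q]` equals `|aK| / |Q|`, at most `1`.
  let K' : AddSubgroup R := K.map (AddMonoidHom.mulLeft (a : R))
  have hK'card : Nat.card K' = Nat.card K :=
    AddSubgroup.card_map_of_injective (fun x y h => a.isUnit.mul_left_cancel h)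
  have hK'Q : K' ≤ Q := by
    rintro _ ⟨r, hr, rfl⟩
    have := hQ r hr x₀ y₀ hx₀ hy₀
    rwa [← ha, mul_comm] at this
  have hcardQ : (Nat.card (R ⧸ Q) : ℝ) * Nat.card Q = Fintype.card R := by
    rw [← Nat.card_eq_fintype_card, AddSubgroup.card_eq_card_quotient_mul_card_addSubgroup Q]
    push_cast; rfl
  have hR : (0 : ℝ) < Fintype.card R := by exact_mod_cast Fintype.card_pos
  have hQpos : (0 : ℝ) < Nat.card Q := by exact_mod_cast Nat.card_pos
  have hmain : (Nat.card K : ℝ) / Fintype.card R * ∑ v ∈ T, ‖charFun p v‖ ≤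
      (Nat.card K' : ℝ) / Nat.card Q * √(collision p (Q : Set R)) := by
    refine (mul_le_mul_of_nonneg_left hsum (by positivity)).trans_eq ?_
    rw [hK'card, ← hcardQ]
    have : (0 : ℝ) < Nat.card (R ⧸ Q) := by exact_mod_cast Nat.card_pos
    field_simp
  refine hmain.trans ?_
  rcases hK'Q.eq_or_lt with heq | hlt
  · have hdiv : ∀ x y, p x ≠ 0 → p y ≠ 0 → ∀ r ∈ K, (a⁻¹ : Rˣ) * (x - y) * r ∈ K := by
      intro x y hx hy r hr
      have := hQ r hr x y hx hy
      rw [← heq] at this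
      obtain ⟨s, hs, hsr⟩ := this
      have : (a⁻¹ : Rˣ) * (x - y) * r = s := by
        rw [mul_assoc, mul_comm (x - y) r, ← hsr]
        simp
      rwa [this]
    -- The stabilizer of `K` contains every `a⁻¹ (x - y₀)`, so the support lies in `y₀ + aS`.
    let S : Subring R :=
      { carrier := {s | ∀ r ∈ K, s * r ∈ K}
        mul_mem' := fun {s t} hs ht r hr => by
          rw [mul_assoc]; exact hs _ (ht r hr)
        one_mem' := fun r hr => by rwa [one_mul]
        add_mem' := fun {s t} hs ht r hr => by
          rw [add_mul]; exact K.add_mem (hs r hr) (ht r hr)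
        zero_mem' := fun r _ => by rw [zero_mul]; exact K.zero_mem
        neg_mem' := fun {s} hs r hr => by
          rw [neg_mul]; exact K.neg_mem (hs r hr) }
    have hS : S = ⊤ := hp.eq_top_of_subring S a y₀ fun x hx =>
      ⟨(a⁻¹ : Rˣ) * (x - y₀), hdiv x y₀ hx hy₀, by simp⟩
    have hideal : ∀ s, ∀ r ∈ K, s * r ∈ K := fun s => (hS ▸ Subring.mem_top s : s ∈ S)
    -- `K` is now an ideal; a unit in it would contradict `flatSubgroup_ne_top`.
    have hsub : (Q : Set R) ⊆ (IsLocalRing.maximalIdeal R : Set R) := by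
      rw [← heq]
      rintro _ ⟨r, hr, rfl⟩
      refine Ideal.mul_mem_left _ _ ?_
      rw [IsLocalRing.mem_maximalIdeal, mem_nonunits_iff]
      rintro ⟨b, rfl⟩
      refine flatSubgroup_ne_top hp hT (eq_top_iff.mpr fun s _ => ?_)
      have := hideal (s * (b⁻¹ : Rˣ)) _ hr
      rwa [mul_assoc, Units.inv_mul, mul_one] at this
    rw [heq, div_self hQpos.ne', one_mul]
    exact le_max_of_le_left (Real.sqrt_le_sqrt (collision_mono hp.nonneg hsub))
  · refine le_max_of_le_right ((mul_le_of_le_one_right (by positivity) ?_).trans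
      (card_div_card_le hlt))
    rw [Real.sqrt_le_one]
    exact (collision_mono hp.nonneg (Set.subset_univ _)).trans_eq (collision_univ hp.sum_eq_one)

variable {ι : Type*} [Fintype ι] [DecidableEq ι]

/-- A single coordinate with `w i ≠ 0` suffices, the other factors being at most `1`. -/
lemma killProb_le_critRate {p : R → ℝ} (hp : IsSpread p) {w : ι → AddChar R ℂ} (hw : w ≠ 0) :
    killProb p w ≤ critRate p := by
  obtain ⟨i, hi⟩ := Function.ne_iff.mp hw
  have hR : (0 : ℝ) < Fintype.card R := by exact_mod_cast Fintype.card_pos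
  refine (killProb_le hp.nonneg w).trans (le_max_of_le_left ?_)
  rw [inv_mul_le_iff₀ hR]
  refine le_trans (Finset.sum_le_sum fun r _ => ?_)
    (sum_norm_charFun_mulShift_le hp.nonneg (ψ := w i) hi)
  rw [← Finset.mul_prod_erase _ _ (Finset.mem_univ i)]
  refine mul_le_of_le_one_right (norm_nonneg _) (Finset.prod_le_one (fun _ _ => norm_nonneg _) ?_)
  exact fun _ _ => norm_charFun_le_one hp.nonneg hp.sum_eq_one _

/-- The annihilator of a tuple of characters. -/
def annihilator (w : ι → AddChar R ℂ) : AddSubgroup R where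
  carrier := {r | ∀ i, (w i).mulShift r = 1}
  zero_mem' := fun i => AddChar.mulShift_zero _
  add_mem' := fun {r s} hr hs i => by rw [← AddChar.mulShift_mul, hr i, hs i, one_mul]
  neg_mem' := fun {r} hr i => by
    ext x
    have := DFunLike.congr_fun (hr i) x
    rw [AddChar.mulShift_apply] at this ⊢
    rw [neg_mul, AddChar.map_neg_eq_inv, this]; simp

/-- The uniform law has `charFun` zero off the trivial character, so only annihilating `r`
contribute. -/
lemma killProb_unifWeight_le (w : ι → AddChar R ℂ) :
    killProb (unifWeight R) w ≤ (Nat.card (annihilator w) : ℝ) / Fintype.card R := by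
  classical
  refine (killProb_le unifWeight_nonneg w).trans_eq ?_
  have : ∀ r : R, ∏ i, ‖charFun (unifWeight R) ((w i).mulShift r)‖ =
      if r ∈ annihilator w then 1 else 0 := by
    intro r
    split_ifs with h
    · refine Finset.prod_eq_one fun i _ => ?_
      rw [charFun_unifWeight, if_pos (show (w i).mulShift r = 0 from h i), norm_one]
    · have : ∃ i, (w i).mulShift r ≠ 1 := by
        by_contra hc
        push Not at hc
        exact h hc
      obtain ⟨i, hi⟩ := this
      refine Finset.prod_eq_zero (Finset.mem_univ i) ?_
      rw [charFun_unifWeight, if_neg (show (w i).mulShift r ≠ 0 from hi), norm_zero]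
  simp only [this]
  rw [Finset.sum_boole, div_eq_inv_mul, Nat.card_eq_fintype_card, Fintype.card_subtype]

lemma killProb_unifWeight_le_critRate (p : R → ℝ) {w : ι → AddChar R ℂ} (hw : w ≠ 0) :
    killProb (unifWeight R) w ≤ critRate p := by
  refine (killProb_unifWeight_le w).trans (le_max_of_le_right ?_)
  have h : annihilator w < ⊤ := by
    refine lt_top_iff_ne_top.mpr fun h => hw ?_
    ext1 i
    have h1 : (1 : R) ∈ annihilator w := h ▸ AddSubgroup.mem_top _
    have := h1 i
    rwa [AddChar.mulShift_one] at this
  have := card_div_card_le h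
  rwa [Nat.card_congr AddSubgroup.topEquiv.toEquiv, Nat.card_eq_fintype_card (α := R)] at this

lemma killProb_unifWeight_le_flat (p : R → ℝ) {w : ι → AddChar R ℂ} {T : Finset (AddChar R ℂ)}
    (hT : ∀ v ∈ T, ∃ i, w i = v) :
    killProb (unifWeight R) w ≤ (Nat.card (flatSubgroup p T) : ℝ) / Fintype.card R := by
  refine (killProb_unifWeight_le w).trans ?_
  have h : annihilator w ≤ flatSubgroup p T := by
    intro r hr v hv x y _ _
    obtain ⟨i, rfl⟩ := hT v hv
    have := DFunLike.congr_fun (hr i) (x - y)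
    simpa using this
  have := AddSubgroup.card_le_of_le h
  gcongr

/-- For `r` outside the flat subgroup, some `v ∈ T` shifted by `r` has `‖charFun‖ ≤ δ`, and this
factor occurs at least `c` times. -/
lemma killProb_le_flat [DecidableEq (AddChar R ℂ)] {p : R → ℝ} (hp : IsSpread p) {δ c : ℝ}
    (hδ0 : 0 < δ) (hδ1 : δ ≤ 1)
    (hδ : ∀ v : AddChar R ℂ, ‖charFun p v‖ < 1 → ‖charFun p v‖ ≤ δ)
    {w : ι → AddChar R ℂ} {T : Finset (AddChar R ℂ)}
    (hT : ∀ v ∈ T, c ≤ (Finset.univ.filter fun i => w i = v).card) :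
    killProb p w ≤ (Nat.card (flatSubgroup p T) : ℝ) / Fintype.card R + δ ^ c := by
  classical
  have hR : (0 : ℝ) < Fintype.card R := by exact_mod_cast Fintype.card_pos
  have hle1 := norm_charFun_le_one hp.nonneg hp.sum_eq_one
  have hterm : ∀ r : R, ∏ i, ‖charFun p ((w i).mulShift r)‖ ≤
      (if r ∈ flatSubgroup p T then 1 else 0) + δ ^ c := by
    intro r
    split_ifs with h
    · refine (Finset.prod_le_one (fun _ _ => norm_nonneg _) fun _ _ => hle1 _).trans ?_
      have : 0 ≤ δ ^ c := by positivity
      linarith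
    · rw [mem_flatSubgroup] at h
      push Not at h
      obtain ⟨v, hv, x, y, hx, hy, hne⟩ := h
      have hlt : ‖charFun p (v.mulShift r)‖ ≤ δ :=
        hδ _ (norm_charFun_lt_one hp.nonneg hp.sum_eq_one hx hy (by simpa using hne))
      rw [zero_add, ← Finset.prod_filter_mul_prod_filter_not Finset.univ (fun i => w i = v)]
      refine (mul_le_of_le_one_right (Finset.prod_nonneg fun _ _ => norm_nonneg _)
        (Finset.prod_le_one (fun _ _ => norm_nonneg _) fun _ _ => hle1 _)).trans ?_
      refine (Finset.prod_le_prod (g := fun _ => δ) (fun _ _ => norm_nonneg _)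
        fun i hi => ?_).trans ?_
      · rw [(Finset.mem_filter.mp hi).2]; exact hlt
      · rw [Finset.prod_const, ← Real.rpow_natCast]
        exact Real.rpow_le_rpow_of_exponent_ge hδ0 hδ1 (hT v hv)
  refine (killProb_le hp.nonneg w).trans ?_
  rw [inv_mul_le_iff₀ hR]
  refine (Finset.sum_le_sum fun r _ => hterm r).trans_eq ?_
  rw [Finset.sum_add_distrib, Finset.sum_boole, Finset.sum_const, Finset.card_univ,
    nsmul_eq_mul, Nat.card_eq_fintype_card, Fintype.card_subtype]
  field_simp

end Structure

/-! ### Tuples grouped by their frequent values. -/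

section FrequentValues

variable {D : Type*} [Fintype D] {ι : Type*} [Fintype ι]

open Classical in
/-- The values that `w` takes more than `c` times. -/
noncomputable def freqValues (c : ℝ) (w : ι → D) : Finset D :=
  Finset.univ.filter fun v => c < (Finset.univ.filter fun i => w i = v).card

open Classical in
lemma card_rare_le {c : ℝ} (hc0 : 0 ≤ c) (w : ι → D) :
    ((Finset.univ.filter fun i => w i ∉ freqValues c w).card : ℝ) ≤ Fintype.card D * c := by
  have h : (Finset.univ.filter fun i => w i ∉ freqValues c w).card =
      ∑ v ∈ (freqValues c w)ᶜ, (Finset.univ.filter fun i => w i = v).card := by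
    rw [Finset.card_eq_sum_card_fiberwise (f := w) (t := (freqValues c w)ᶜ)
      (fun i hi => by simpa using hi)]
    refine Finset.sum_congr rfl fun v hv => congrArg Finset.card ?_
    ext i
    simp only [Finset.mem_filter, Finset.mem_univ, true_and, and_iff_right_iff_imp]
    rintro rfl
    simpa using hv
  rw [h]
  push_cast
  have hc : ∀ v ∈ (freqValues c w)ᶜ, ((Finset.univ.filter fun i => w i = v).card : ℝ) ≤ c := by
    intro v hv
    simpa [freqValues] using hv
  refine (Finset.sum_le_sum hc).trans ?_
  rw [Finset.sum_const, nsmul_eq_mul]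
  gcongr
  exact Finset.card_le_univ _

open Classical in
/-- Total weight of the tuples with a given set of frequent values. -/
lemma sum_prod_freqValues_le [DecidableEq ι] {φ : D → ℝ} (h0 : ∀ v, 0 ≤ φ v) (h1 : ∀ v, φ v ≤ 1)
    {t c : ℝ} (ht0 : 0 < t) (ht1 : t ≤ 1) (hc0 : 0 ≤ c) (T : Finset D) :
    t ^ (Fintype.card D * c) * ∑ w : ι → D with freqValues c w = T, ∏ i, φ (w i) ≤
      (∑ v ∈ T, φ v + t * Fintype.card D) ^ Fintype.card ι := by
  -- A rare coordinate is charged at most `t`. At most `|D| c` coordinates are rare, so the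
  -- prefactor pays for the charge, and the constraint on `w` can be dropped to make the sum factor.
  let g : D → ℝ := fun v => if v ∈ T then φ v else t
  have hg0 : ∀ v, 0 ≤ g v := fun v => by
    simp only [g]; split_ifs; exacts [h0 v, ht0.le]
  have hw : ∀ w : ι → D, freqValues c w = T →
      t ^ (Fintype.card D * c) * ∏ i, φ (w i) ≤ ∏ i, g (w i) := by
    intro w hw
    have e : ∏ i, (if w i ∈ T then (1 : ℝ) else t) =
        t ^ (Finset.univ.filter fun i => w i ∉ T).card := by
      rw [Finset.prod_ite, Finset.prod_const_one, one_mul, Finset.prod_const]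
    have hle : t ^ (Fintype.card D * c) ≤ ∏ i, (if w i ∈ T then (1 : ℝ) else t) := by
      rw [e, ← Real.rpow_natCast]
      refine Real.rpow_le_rpow_of_exponent_ge ht0 ht1 ?_
      rw [← hw]
      exact card_rare_le hc0 w
    refine (mul_le_mul_of_nonneg_right hle (Finset.prod_nonneg fun i _ => h0 _)).trans ?_
    rw [← Finset.prod_mul_distrib]
    refine Finset.prod_le_prod (fun i _ => ?_) fun i _ => ?_
    · exact mul_nonneg (by split_ifs; exacts [zero_le_one, ht0.le]) (h0 _)
    · simp only [g]
      split_ifs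
      · rw [one_mul]
      · exact mul_le_of_le_one_right ht0.le (h1 _)
  rw [Finset.mul_sum]
  calc ∑ w : ι → D with freqValues c w = T, t ^ (Fintype.card D * c) * ∏ i, φ (w i)
      ≤ ∑ w : ι → D with freqValues c w = T, ∏ i, g (w i) :=
        Finset.sum_le_sum fun w h => hw w (Finset.mem_filter.mp h).2
    _ ≤ ∑ w : ι → D, ∏ i, g (w i) :=
        Finset.sum_le_sum_of_subset_of_nonneg (Finset.filter_subset _ _)
          fun w _ _ => Finset.prod_nonneg fun i _ => hg0 _
    _ = (∑ v, g v) ^ Fintype.card ι := by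
        rw [← Fintype.prod_sum (fun (_ : ι) v => g v), Finset.prod_const, Finset.card_univ]
    _ ≤ _ := by
        refine pow_le_pow_left₀ (Finset.sum_nonneg fun v _ => hg0 v) ?_ _
        rw [Finset.sum_ite]
        have e1 : (Finset.univ.filter fun v => v ∈ T) = T := by ext; simp
        rw [e1, Finset.sum_const, nsmul_eq_mul, mul_comm]
        gcongr
        exact Finset.card_le_univ _

end FrequentValues

/-! ### The exponential bound for the character sum. -/

section Rate

lemma exists_rpow_gt {t s : ℝ} (ht : 0 < t) (hs : s < 1) : ∃ e : ℝ, 0 < e ∧ s < t ^ e := by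
  have h : Tendsto (fun e : ℝ => t ^ e) (𝓝[>] 0) (𝓝 1) := by
    have := (Real.continuous_const_rpow ht.ne').tendsto 0
    rw [Real.rpow_zero] at this
    exact this.mono_left nhdsWithin_le_nhds
  obtain ⟨e, he, he0⟩ := ((h.eventually (lt_mem_nhds hs)).and self_mem_nhdsWithin).exists
  exact ⟨e, he0, he⟩

/-- Keeps the accumulated error of the kill rates bounded over about `n` columns; it holds because
`n * y ^ n` is bounded. -/
lemma exists_one_add_mul_pow_le (B : ℝ) (hB : 0 ≤ B) {y : ℝ} (hy0 : 0 ≤ y) (hy1 : y < 1) :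
    ∃ C : ℝ, 0 ≤ C ∧ ∀ n : ℕ, (1 + B * y ^ n) ^ n ≤ C := by
  obtain ⟨M, hM⟩ := (tendsto_self_mul_const_pow_of_lt_one hy0 hy1).bddAbove_range
  refine ⟨Real.exp (B * M), (Real.exp_pos _).le, fun n => ?_⟩
  have hn : (n : ℝ) * y ^ n ≤ M := hM ⟨n, rfl⟩
  calc (1 + B * y ^ n) ^ n ≤ Real.exp (B * y ^ n) ^ n := by
        refine pow_le_pow_left₀ (by positivity) ?_ n
        rw [add_comm]; exact Real.add_one_le_exp _
    _ = Real.exp (B * (n * y ^ n)) := by rw [← Real.exp_nat_mul]; ring_nf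
    _ ≤ _ := Real.exp_le_exp.mpr (mul_le_mul_of_nonneg_left hn hB)

variable {R : Type v} [CommRing R] [Fintype R] [IsLocalRing R]

open Classical in
/-- A bound for `killProb` in terms of the frequent values, up to a factor tending to `1`. -/
noncomputable def killRate (p : R → ℝ) (T : Finset (AddChar R ℂ)) : ℝ :=
  if ∃ v ∈ T, v ≠ 0 then (Nat.card (flatSubgroup p T) : ℝ) / Fintype.card R else critRate p

lemma inv_card_le_killRate (p : R → ℝ) (T : Finset (AddChar R ℂ)) :
    (Fintype.card R : ℝ)⁻¹ ≤ killRate p T := by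
  unfold killRate
  split_ifs
  · rw [inv_eq_one_div]
    have : (1 : ℝ) ≤ Nat.card (flatSubgroup p T) := by
      exact_mod_cast Nat.card_pos (α := flatSubgroup p T)
    gcongr
  · exact inv_card_le_critRate p

lemma killRate_le_one {p : R → ℝ} (hc : critRate p ≤ 1) (T : Finset (AddChar R ℂ)) :
    killRate p T ≤ 1 := by
  unfold killRate
  split_ifs
  · refine div_le_one_of_le₀ ?_ (by positivity)
    rw [← Nat.card_eq_fintype_card]
    exact_mod_cast AddSubgroup.card_le_card_addGroup _
  · exact hc

lemma killRate_mul_sum_le {p : R → ℝ} (hp : IsSpread p) (T : Finset (AddChar R ℂ)) :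
    killRate p T * ∑ v ∈ T, ‖charFun p v‖ ≤ critRate p := by
  unfold killRate
  split_ifs with h
  · exact card_flatSubgroup_mul_sum_le hp h
  · refine mul_le_of_le_one_right (critRate_pos p).le ?_
    push Not at h
    have hT : T ⊆ {0} := fun v hv => Finset.mem_singleton.mpr (h v hv)
    refine (Finset.sum_le_sum_of_subset_of_nonneg hT fun _ _ _ => norm_nonneg _).trans ?_
    rw [Finset.sum_singleton]
    exact norm_charFun_le_one hp.nonneg hp.sum_eq_one _

open Classical in
/-- Exponential bound for the sum that controls the replacement of a column. -/
lemma exists_sum_killProb_le {p : R → ℝ} (hp : IsSpread p) {θ : ℝ} (hθ : critRate p < θ)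
    (hθ1 : θ < 1) (d : ℕ) : ∃ C : ℝ, 0 ≤ C ∧ ∀ n m : ℕ, n ≤ m + d → m ≤ n + d →
      ∃ ρ : (Fin n → AddChar R ℂ) → ℝ, (∀ w, w ≠ 0 → killProb p w ≤ ρ w) ∧
        (∀ w, w ≠ 0 → killProb (unifWeight R) w ≤ ρ w) ∧
        ∑ w : Fin n → AddChar R ℂ with w ≠ 0, (∏ i, ‖charFun p (w i)‖) * ρ w ^ m ≤ C * θ ^ n := by
  have hpos := critRate_pos p
  have hθ0 : 0 < θ := hpos.trans hθ
  set N : ℝ := (Fintype.card (AddChar R ℂ) : ℝ) with hN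
  have hN1 : 1 ≤ N := by
    rw [hN]; exact_mod_cast Fintype.card_pos (α := AddChar R ℂ)
  have hR : (0 : ℝ) < Fintype.card R := by exact_mod_cast Fintype.card_pos
  set B : ℝ := (Fintype.card R : ℝ) with hB
  obtain ⟨δ, hδ0, hδ1, hδ⟩ : ∃ δ : ℝ, 0 < δ ∧ δ < 1 ∧
      ∀ v : AddChar R ℂ, ‖charFun p v‖ < 1 → ‖charFun p v‖ ≤ δ := by
    have : ∀ᶠ δ in 𝓝[<] (1 : ℝ), ∀ v : AddChar R ℂ, ‖charFun p v‖ < 1 → ‖charFun p v‖ ≤ δ := by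
      rw [eventually_all]
      intro v
      rw [eventually_imp_distrib_left]
      intro hv
      filter_upwards [Ioo_mem_nhdsLT hv] with δ hδ using hδ.1.le
    obtain ⟨δ, h1, h2⟩ := (this.and (Ioo_mem_nhdsLT (zero_lt_one' ℝ))).exists
    exact ⟨δ, h2.1, h2.2, h1⟩
  -- Then `critRate p + t * N` is the midpoint of `critRate p` and `θ`.
  set t : ℝ := (θ - critRate p) / (2 * N) with ht
  have ht0 : 0 < t := by
    have : 0 < θ - critRate p := sub_pos.mpr hθ
    positivity
  have htN : t * N = (θ - critRate p) / 2 := by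
    rw [ht]; field_simp
  have ht1 : t ≤ 1 := by
    have : t ≤ t * N := le_mul_of_one_le_right ht0.le hN1
    linarith
  have hs : (critRate p + t * N) / θ < 1 := by
    rw [div_lt_one hθ0]; linarith
  -- There will be at most `N * ε * n = e * n` rare coordinates, costing `t ^ (-e)` per coordinate;
  -- `e` is small enough to keep the base below `θ`.
  obtain ⟨e, he0, he⟩ := exists_rpow_gt ht0 hs
  rw [div_lt_iff₀ hθ0] at he
  set ε : ℝ := e / N with hε
  have hε0 : 0 < ε := by positivity
  have hNε : N * ε = e := by rw [hε]; field_simp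
  set y : ℝ := δ ^ ε with hy
  have hy0 : 0 < y := by positivity
  have hy1 : y < 1 := Real.rpow_lt_one hδ0.le hδ1 hε0
  obtain ⟨C₁, hC₁0, hC₁⟩ := exists_one_add_mul_pow_le B hR.le hy0.le hy1
  refine ⟨B ^ d * ((1 + B) ^ d * C₁) * Fintype.card (Finset (AddChar R ℂ)), by positivity, ?_⟩
  intro n m hnm hmn
  set z : ℝ := 1 + B * y ^ n with hz
  have hz1 : 1 ≤ z := by
    have : 0 ≤ B * y ^ n := by positivity
    linarith
  have hzB : z ≤ 1 + B := by
    have := mul_le_of_le_one_right hR.le (pow_le_one₀ hy0.le hy1.le (n := n))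
    linarith
  have hk0 : ∀ T, 0 < killRate p T := fun T => lt_of_lt_of_le (by positivity)
    (inv_card_le_killRate p T)
  -- As `killRate` is at least `1 / B`, the additive error `y ^ n` becomes a factor `z`.
  have hkz : ∀ T, killRate p T + y ^ n ≤ killRate p T * z := by
    intro T
    have h := mul_le_mul_of_nonneg_right (inv_card_le_killRate p T)
      (show 0 ≤ B * y ^ n by positivity)
    rw [inv_mul_cancel_left₀ hR.ne'] at h
    rw [hz]; linarith
  have hyn : δ ^ (ε * n) = y ^ n := by
    rw [hy, Real.rpow_mul hδ0.le, Real.rpow_natCast]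
  have hfreq : ∀ w : Fin n → AddChar R ℂ, ∀ v ∈ freqValues (ε * n) w,
      ε * n < (Finset.univ.filter fun i => w i = v).card := by
    intro w v hv
    exact (Finset.mem_filter.mp hv).2
  refine ⟨fun w => killRate p (freqValues (ε * n) w) * z, ?_, ?_, ?_⟩
  · intro w hw
    refine le_trans ?_ (hkz _)
    by_cases h : ∃ v ∈ freqValues (ε * n) w, v ≠ 0
    · have := killProb_le_flat hp hδ0 hδ1.le hδ (w := w) (fun v hv => (hfreq w v hv).le)
      rwa [hyn, ← hB, show _ / B = killRate p _ from (if_pos h).symm] at this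
    · have := killProb_le_critRate hp hw
      have hyn0 : 0 < y ^ n := by positivity
      rw [killRate, if_neg h]
      linarith
  · intro w hw
    refine le_trans ?_ ((le_mul_of_one_le_right (hk0 _).le hz1))
    by_cases h : ∃ v ∈ freqValues (ε * n) w, v ≠ 0
    · rw [killRate, if_pos h]
      refine killProb_unifWeight_le_flat p fun v hv => ?_
      have h1 := hfreq w v hv
      have h2 : (0 : ℝ) < (Finset.univ.filter fun i => w i = v).card :=
        lt_of_le_of_lt (by positivity) h1
      obtain ⟨i, hi⟩ := Finset.card_pos.mp (by exact_mod_cast h2)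
      exact ⟨i, (Finset.mem_filter.mp hi).2⟩
    · rw [killRate, if_neg h]
      exact killProb_unifWeight_le_critRate p hw
  · have hF0 : ∀ w : Fin n → AddChar R ℂ, 0 ≤ ∏ i, ‖charFun p (w i)‖ := fun w => by positivity
    have hpow : ∀ T, (killRate p T * z) ^ m ≤
        B ^ d * ((1 + B) ^ d * C₁) * killRate p T ^ n := by
      intro T
      have hk1 := killRate_le_one (hθ.trans hθ1).le T
      have hBk : 1 ≤ B * killRate p T := by
        have := inv_card_le_killRate p T
        rwa [inv_le_iff_one_le_mul₀' hR] at this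
      -- `m` may fall short of `n` by `d`; each missing factor is paid for by `B * killRate p T ≥
      -- 1`.
      have h1 : killRate p T ^ m ≤ B ^ d * killRate p T ^ n := by
        calc killRate p T ^ m ≤ killRate p T ^ m * (B * killRate p T) ^ d :=
              le_mul_of_one_le_right (pow_nonneg (hk0 T).le _) (one_le_pow₀ hBk)
          _ = B ^ d * killRate p T ^ (m + d) := by ring
          _ ≤ _ := mul_le_mul_of_nonneg_left
              (pow_le_pow_of_le_one (hk0 T).le hk1 hnm) (by positivity)
      have h2 : z ^ m ≤ (1 + B) ^ d * C₁ := by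
        calc z ^ m ≤ z ^ (n + d) := pow_le_pow_right₀ hz1 hmn
          _ = z ^ d * z ^ n := by ring
          _ ≤ _ := mul_le_mul (pow_le_pow_left₀ (by linarith) hzB d) (hC₁ n)
              (pow_nonneg (by linarith) _) (by positivity)
      rw [mul_pow]
      refine (mul_le_mul h1 h2 (pow_nonneg (by linarith) _)
        (mul_nonneg (by positivity) (pow_nonneg (hk0 T).le _))).trans_eq ?_
      ring
    have hT : ∀ T, killRate p T ^ n *
        ∑ w : Fin n → AddChar R ℂ with freqValues (ε * n) w = T, ∏ i, ‖charFun p (w i)‖ ≤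
        θ ^ n := by
      intro T
      have h := sum_prod_freqValues_le (ι := Fin n) (φ := fun v => ‖charFun p v‖)
        (fun v => norm_nonneg _) (fun v => norm_charFun_le_one hp.nonneg hp.sum_eq_one v)
        (c := ε * n) ht0 ht1 (by positivity) T
      rw [← hN, Fintype.card_fin, ← mul_assoc, hNε, Real.rpow_mul ht0.le, Real.rpow_natCast] at h
      have hte : (0 : ℝ) < t ^ e := by positivity
      have hb : killRate p T * (∑ v ∈ T, ‖charFun p v‖ + t * N) ≤ t ^ e * θ := by
        have h1 := killRate_mul_sum_le hp T
        have h2 : killRate p T * (t * N) ≤ t * N :=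
          mul_le_of_le_one_left (by positivity) (killRate_le_one (hθ.trans hθ1).le T)
        rw [mul_add]; linarith
      have hb' := pow_le_pow_left₀ (mul_nonneg (hk0 T).le (by positivity)) hb n
      have h3 := mul_le_mul_of_nonneg_left h (pow_nonneg (hk0 T).le n)
      rw [← mul_pow] at h3
      have h4 := h3.trans hb'
      rw [mul_pow, mul_left_comm] at h4
      exact le_of_mul_le_mul_left h4 (by positivity)
    calc ∑ w : Fin n → AddChar R ℂ with w ≠ 0,
          (∏ i, ‖charFun p (w i)‖) * (killRate p (freqValues (ε * n) w) * z) ^ m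
        ≤ ∑ w : Fin n → AddChar R ℂ,
          (∏ i, ‖charFun p (w i)‖) * (killRate p (freqValues (ε * n) w) * z) ^ m :=
          Finset.sum_le_sum_of_subset_of_nonneg (Finset.filter_subset _ _) fun w _ _ =>
            mul_nonneg (hF0 w) (pow_nonneg (mul_nonneg (hk0 _).le (by linarith)) _)
      _ ≤ ∑ w : Fin n → AddChar R ℂ, B ^ d * ((1 + B) ^ d * C₁) *
          ((∏ i, ‖charFun p (w i)‖) * killRate p (freqValues (ε * n) w) ^ n) :=
          Finset.sum_le_sum fun w _ =>
            (mul_le_mul_of_nonneg_left (hpow _) (hF0 w)).trans_eq (by ring)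
      _ = B ^ d * ((1 + B) ^ d * C₁) * ∑ T, killRate p T ^ n *
          ∑ w : Fin n → AddChar R ℂ with freqValues (ε * n) w = T, ∏ i, ‖charFun p (w i)‖ := by
          rw [← Finset.mul_sum, ← Finset.sum_fiberwise Finset.univ (freqValues (ε * n))]
          congr 1
          refine Finset.sum_congr rfl fun T _ => ?_
          rw [Finset.mul_sum]
          refine Finset.sum_congr rfl fun w hw => ?_
          rw [(Finset.mem_filter.mp hw).2, mul_comm]
      _ ≤ B ^ d * ((1 + B) ^ d * C₁) * ∑ _T : Finset (AddChar R ℂ), θ ^ n :=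
          mul_le_mul_of_nonneg_left (Finset.sum_le_sum fun T _ => hT T) (by positivity)
      _ = _ := by
          rw [Finset.sum_const, Finset.card_univ, nsmul_eq_mul]; ring

end Rate

/-! ### From probability laws to weights. -/

section Laws

variable {R : Type v} [CommRing R] [Fintype R]

/-- The weights of a discrete law as real numbers. -/
noncomputable def weight (ξ : PMF R) (x : R) : ℝ := (ξ x).toReal

lemma weight_nonneg (ξ : PMF R) (x : R) : 0 ≤ weight ξ x := ENNReal.toReal_nonneg

lemma sum_weight (ξ : PMF R) : ∑ x, weight ξ x = 1 := by
  unfold weight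
  rw [← ENNReal.toReal_sum fun x _ => ξ.apply_ne_top x, ← tsum_fintype (L := .unconditional _),
    ξ.tsum_coe, ENNReal.toReal_one]

lemma weight_ne_zero_iff {ξ : PMF R} {x : R} : weight ξ x ≠ 0 ↔ x ∈ ξ.support := by
  rw [weight, PMF.mem_support_iff, ne_eq, ENNReal.toReal_eq_zero_iff]
  simp [ξ.apply_ne_top x]

lemma weight_uniformOfFintype : weight (PMF.uniformOfFintype R) = unifWeight R := by
  ext x
  simp [weight, unifWeight]

/-- In a local ring the nonunits form an ideal, so without a unit difference the support would lie
in one of its translates. -/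
lemma isSpread_weight [IsLocalRing R] {ξ : PMF R} (hideal : ¬ ConcentratedOnIdealTranslate ξ)
    (hsubring : ¬ ConcentratedOnSubringTranslate ξ) : IsSpread (weight ξ) where
  nonneg := weight_nonneg ξ
  sum_eq_one := sum_weight ξ
  exists_isUnit_sub := by
    by_contra! h
    obtain ⟨x₀, hx₀⟩ := ξ.support_nonempty
    refine hideal ⟨IsLocalRing.maximalIdeal R, x₀, Ideal.IsPrime.ne_top', fun x hx =>
      ⟨x - x₀, ?_, by ring⟩⟩
    exact h x x₀ (weight_ne_zero_iff.mpr hx) (weight_ne_zero_iff.mpr hx₀)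
  eq_top_of_subring := fun S a b h => by
    by_contra hS
    exact hsubring ⟨S, a, b, hS, fun x hx => h x (weight_ne_zero_iff.mpr hx)⟩

/-- Two independent samples agree modulo the maximal ideal with probability the sum of squares of
the residue law. -/
lemma sqrt_collision_eq_l2Norm [IsLocalRing R] (ξ : PMF R) :
    √(collision (weight ξ) (IsLocalRing.maximalIdeal R : Set R)) = l2Norm (modMax ξ) := by
  classical
  have : Finite (IsLocalRing.ResidueField R) :=
    Finite.of_surjective _ (IsLocalRing.residue_surjective (R := R))
  have := Fintype.ofFinite (IsLocalRing.ResidueField R)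
  have hm : ∀ a, (modMax ξ a).toReal =
      ∑ x, if a = IsLocalRing.residue R x then weight ξ x else 0 := by
    intro a
    rw [modMax, PMF.map_apply, tsum_fintype, ENNReal.toReal_sum]
    · refine Finset.sum_congr rfl fun x _ => ?_
      split_ifs <;> simp [weight]
    · intro x _
      split_ifs
      exacts [ξ.apply_ne_top x, ENNReal.zero_ne_top]
  rw [l2Norm, tsum_fintype]
  congr 1
  simp only [hm, sq, Finset.sum_mul_sum]
  rw [Finset.sum_comm, collision]
  refine Finset.sum_congr rfl fun x _ => ?_
  rw [Finset.sum_comm]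
  refine Finset.sum_congr rfl fun y _ => ?_
  have e : x - y ∈ (IsLocalRing.maximalIdeal R : Set R) ↔
      IsLocalRing.residue R x = IsLocalRing.residue R y := by
    rw [SetLike.mem_coe, ← IsLocalRing.residue_eq_zero_iff, map_sub, sub_eq_zero]
  rw [Finset.sum_eq_single (IsLocalRing.residue R x)]
  · simp [e]
  · intro a _ ha
    simp [ha]
  · simp

/-- Provides an admissible rate below `1`, from which plain convergence follows. -/
lemma critRate_lt_one [IsLocalRing R] {p : R → ℝ} (hp : IsSpread p) : critRate p < 1 := by
  classical
  refine max_lt ?_ ?_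
  · rw [Real.sqrt_lt' one_pos, one_pow]
    have huniv : ∑ a, ∑ b, p a * p b = 1 := by simp [← Finset.mul_sum, hp.sum_eq_one]
    rw [← huniv]
    obtain ⟨x, y, hx, hy, hu⟩ := hp.exists_isUnit_sub
    have hpos : 0 < p x * p y :=
      mul_pos ((hp.nonneg x).lt_of_ne' hx) ((hp.nonneg y).lt_of_ne' hy)
    have hle : ∀ a b, p a * p b * (if a - b ∈ (IsLocalRing.maximalIdeal R : Set R) then 1 else 0) ≤
        p a * p b := fun a b =>
      mul_le_of_le_one_right (mul_nonneg (hp.nonneg a) (hp.nonneg b)) (by split_ifs <;> simp)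
    refine Finset.sum_lt_sum (fun a _ => Finset.sum_le_sum fun b _ => hle a b)
      ⟨x, Finset.mem_univ x, Finset.sum_lt_sum (fun b _ => hle x b) ⟨y, Finset.mem_univ y, ?_⟩⟩
    have hnot : x - y ∉ (IsLocalRing.maximalIdeal R : Set R) := fun h => h hu
    rw [if_neg hnot, mul_zero]
    exact hpos
  · have := (prime_ringChar_residueField (R := R)).one_lt
    rw [div_lt_one (by positivity)]
    exact_mod_cast this

lemma tvDist_nonneg {α : Type*} (P Q : PMF α) : 0 ≤ tvDist P Q :=
  Real.iSup_nonneg fun _ => abs_nonneg _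

end Laws

/-! ### Column-invariant functions of matrices and their laws. -/

section Matrices

variable {R : Type v} [CommRing R]

/-- The function `f` of a matrix does not change when a combination of the other columns is added
to a column. -/
def ColInvariant {n k : ℕ} {β : Type*} (f : Matrix (Fin n) (Fin k) R → β) : Prop :=
  ∀ (M : Matrix (Fin n) (Fin k) R) (j : Fin k), ∀ y ∈ Submodule.span R (Set.image M.col {j}ᶜ),
    f (M.updateCol j (M.col j + y)) = f M

lemma ColInvariant.comp {n k : ℕ} {β γ : Type*} {f : Matrix (Fin n) (Fin k) R → β}
    (hf : ColInvariant f) (g : β → γ) : ColInvariant fun M => g (f M) :=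
  fun M j y hy => congrArg g (hf M j y hy)

lemma ColInvariant.prodMk {n k : ℕ} {β γ : Type*} {f : Matrix (Fin n) (Fin k) R → β}
    {g : Matrix (Fin n) (Fin k) R → γ} (hf : ColInvariant f) (hg : ColInvariant g) :
    ColInvariant fun M => (f M, g M) :=
  fun M j y hy => Prod.ext (hf M j y hy) (hg M j y hy)

lemma col_updateCol {n k : ℕ} (M : Matrix (Fin n) (Fin k) R) (j : Fin k) (b : Fin n → R) :
    (M.updateCol j b).col = Function.update M.col j b := by
  ext l i
  rcases eq_or_ne l j with rfl | h
  · rw [Function.update_self]; exact Matrix.updateCol_self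
  · rw [Function.update_of_ne h]; exact Matrix.updateCol_ne h

lemma image_col_updateCol {n k : ℕ} (M : Matrix (Fin n) (Fin k) R) (j : Fin k) (b : Fin n → R) :
    Set.image (M.updateCol j b).col {j}ᶜ = Set.image M.col {j}ᶜ := by
  rw [col_updateCol]
  exact Set.image_congr fun l hl => Function.update_of_ne hl _ _

lemma colSpan_updateCol_le {n k : ℕ} (M : Matrix (Fin n) (Fin k) R) (j : Fin k) {y : Fin n → R}
    (hy : y ∈ Submodule.span R (Set.image M.col {j}ᶜ)) :
    colSpan (M.updateCol j (M.col j + y)) ≤ colSpan M := by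
  rw [colSpan, Submodule.span_le]
  rintro _ ⟨l, rfl⟩
  rw [col_updateCol]
  rcases eq_or_ne l j with rfl | h
  · rw [Function.update_self]
    exact Submodule.add_mem _ (Submodule.subset_span ⟨l, rfl⟩)
      (Submodule.span_mono (Set.image_subset_range _ _) hy)
  · rw [Function.update_of_ne h]
    exact Submodule.subset_span ⟨l, rfl⟩

lemma colInvariant_colSpan {n k : ℕ} :
    ColInvariant (fun M : Matrix (Fin n) (Fin k) R => colSpan M) := by
  intro M j y hy
  refine le_antisymm (colSpan_updateCol_le M j hy) ?_
  have h := colSpan_updateCol_le (M.updateCol j (M.col j + y)) j (y := -y)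
    (by rw [image_col_updateCol]; exact Submodule.neg_mem _ hy)
  have e : (M.updateCol j (M.col j + y)).updateCol j
      ((M.updateCol j (M.col j + y)).col j + -y) = M := by
    rw [col_updateCol, Function.update_self, add_neg_cancel_right]
    ext i l
    rcases eq_or_ne l j with rfl | hl
    · simp [Matrix.col]
    · simp [hl]
  rwa [e] at h

lemma colInvariant_det {n : ℕ} :
    ColInvariant (fun M : Matrix (Fin n) (Fin n) R => M.det) := by
  intro M j y hy
  have h0 : (M.updateCol j y).det = 0 := by
    induction hy using Submodule.span_induction with
    | mem y hy =>
      obtain ⟨l, hl, rfl⟩ := hy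
      refine Matrix.det_zero_of_column_eq (i := l) (j := j) hl fun i => ?_
      rw [Matrix.updateCol_self, Matrix.updateCol_ne hl]
      rfl
    | zero => exact Matrix.det_eq_zero_of_column_eq_zero j fun i => by simp
    | add x y _ _ hx hy => rw [Matrix.det_updateCol_add, hx, hy, add_zero]
    | smul r x _ hx => rw [Matrix.det_updateCol_smul, hx, mul_zero]
  have e : M.updateCol j (M.col j) = M := by
    ext i l
    rcases eq_or_ne l j with rfl | hl
    · simp [Matrix.col]
    · simp [hl]
  change (M.updateCol j (M.col j + y)).det = M.det
  rw [Matrix.det_updateCol_add, h0, add_zero, e]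

/-- The cokernel depends only on the column span, and so inherits its invariance. -/
lemma cokerClass_eq {n k : ℕ} (M : Matrix (Fin n) (Fin k) R) :
    cokerClass M = Quotient.mk _ (ModuleCat.of R ((Fin n → R) ⧸ colSpan M)) := by
  have h : LinearMap.range M.mulVecLin = colSpan M := Matrix.range_mulVecLin M
  rw [cokerClass, h]

lemma colInvariant_cokerClass {n k : ℕ} :
    ColInvariant (fun M : Matrix (Fin n) (Fin k) R => cokerClass M) := by
  simp only [cokerClass_eq]
  exact colInvariant_colSpan.comp
    fun N => (Quotient.mk _ (ModuleCat.of R ((Fin n → R) ⧸ N)) : ModuleClass R)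

variable [Fintype R]

open Classical in
lemma toReal_iidMatrix_map (ξ : PMF R) {n k : ℕ} {β : Type*}
    (f : Matrix (Fin n) (Fin k) R → β) (A : Set β) :
    (((iidMatrix ξ n k).map f).toOuterMeasure A).toReal =
      ∑ c : Fin k → Fin n → R, (∏ j, ∏ i, weight ξ (c j i)) *
        if f (Matrix.of c).transpose ∈ A then 1 else 0 := by
  rw [PMF.toOuterMeasure_map_apply, PMF.toOuterMeasure_apply_fintype, ENNReal.toReal_sum]
  · let e : (Fin k → Fin n → R) ≃ Matrix (Fin n) (Fin k) R :=
      { toFun := fun c => (Matrix.of c).transpose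
        invFun := fun M => M.transpose
        left_inv := fun c => rfl
        right_inv := fun M => rfl }
    rw [← e.sum_comp]
    refine Finset.sum_congr rfl fun c _ => ?_
    rw [Set.indicator_apply]
    have hw : (iidMatrix ξ n k (e c)).toReal = ∏ j, ∏ i, weight ξ (c j i) := by
      change (∏ i, ∏ j, ξ (c j i)).toReal = _
      rw [Finset.prod_comm]
      simp only [ENNReal.toReal_prod]
      rfl
    have hm : e c ∈ Set.preimage f A ↔ f (Matrix.of c).transpose ∈ A := Iff.rfl
    simp only [hm]
    split_ifs
    · rw [hw, mul_one]
    · simp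
  · intro M _
    rw [Set.indicator_apply]
    split_ifs
    exacts [PMF.apply_ne_top _ _, ENNReal.zero_ne_top]

open Classical in
/-- Column-invariant functions of a random matrix have nearly the same law as for the uniform
matrix. -/
lemma distToUniform_le (ξ : PMF R) {n k : ℕ} {β : Type*}
    {f : Matrix (Fin n) (Fin k) R → β} (hf : ColInvariant f)
    {ρ : (Fin n → AddChar R ℂ) → ℝ} (hρ : ∀ w, w ≠ 0 → killProb (weight ξ) w ≤ ρ w)
    (hρ' : ∀ w, w ≠ 0 → killProb (unifWeight R) w ≤ ρ w) :
    distToUniform ξ f ≤ k * ∑ w : Fin n → AddChar R ℂ with w ≠ 0,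
      (∏ i, ‖charFun (weight ξ) (w i)‖) * ρ w ^ (k - 1) := by
  refine ciSup_le fun A => ?_
  rw [toReal_iidMatrix_map, toReal_iidMatrix_map, weight_uniformOfFintype,
    ← Finset.sum_sub_distrib]
  simp only [← sub_mul]
  refine abs_sum_prod_sub_le (weight_nonneg ξ) (sum_weight ξ) (fun c => ?_) (fun c j y hy => ?_)
    hρ hρ'
  · split_ifs <;> simp
  · have h := hf (Matrix.of c).transpose j y hy
    have e : (Matrix.of (Function.update c j (c j + y))).transpose =
        (Matrix.of c).transpose.updateCol j ((Matrix.of c).transpose.col j + y) := by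
      rw [Matrix.updateCol_transpose]; rfl
    rw [e, h]

/-- Absorbs the number of columns by raising the base from `s` to `θ`. -/
lemma exists_nat_add_mul_pow_le (d : ℕ) {s θ : ℝ} (hs0 : 0 < s) (hs : s < θ) :
    ∃ C : ℝ, ∀ n : ℕ, ((n : ℝ) + d) * s ^ n ≤ C * θ ^ n := by
  have hθ : 0 < θ := hs0.trans hs
  have hr0 : 0 ≤ s / θ := by positivity
  have hr1 : s / θ < 1 := (div_lt_one hθ).mpr hs
  obtain ⟨M, hM⟩ := (tendsto_self_mul_const_pow_of_lt_one hr0 hr1).bddAbove_range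
  refine ⟨M + d, fun n => ?_⟩
  have h1 : (n : ℝ) * (s / θ) ^ n ≤ M := hM ⟨n, rfl⟩
  have h2 : (d : ℝ) * (s / θ) ^ n ≤ d :=
    mul_le_of_le_one_right (by positivity) (pow_le_one₀ hr0 hr1.le)
  have h3 : s ^ n = (s / θ) ^ n * θ ^ n := by rw [← mul_pow, div_mul_cancel₀ _ hθ.ne']
  rw [h3, ← mul_assoc]
  refine mul_le_mul_of_nonneg_right ?_ (by positivity)
  rw [add_mul]; linarith

/-- Exponential rate, for all column-invariant functions of a random `n × (n + u)` matrix. -/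
lemma exists_distToUniform_le [IsLocalRing R] {ξ : PMF R} (hξ : IsSpread (weight ξ)) {θ : ℝ}
    (hθ : critRate (weight ξ) < θ) (hθ1 : θ < 1) (u : ℤ) :
    ∃ C : ℝ, ∀ n k : ℕ, (k : ℤ) = n + u → ∀ {β : Type*} (f : Matrix (Fin n) (Fin k) R → β),
      ColInvariant f → distToUniform ξ f ≤ C * θ ^ n := by
  classical
  obtain ⟨s, hs, hsθ⟩ := exists_between hθ
  obtain ⟨C, hC0, hC⟩ := exists_sum_killProb_le hξ hs (hsθ.trans hθ1) (u.natAbs + 1)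
  obtain ⟨C', hC'⟩ := exists_nat_add_mul_pow_le u.natAbs ((critRate_pos _).trans hs) hsθ
  refine ⟨C * C', fun n k hk β f hf => ?_⟩
  -- The slack `|u| + 1` covers the exponent `k - 1`, including its truncation at `k = 0`.
  obtain ⟨ρ, hρ, hρ', hle⟩ := hC n (k - 1) (by omega) (by omega)
  refine (distToUniform_le ξ hf hρ hρ').trans ?_
  have hkn : (k : ℝ) ≤ n + u.natAbs := by
    have : k ≤ n + u.natAbs := by omega
    exact_mod_cast this
  have hs0 : 0 < s := (critRate_pos _).trans hs
  calc (k : ℝ) * _ ≤ k * (C * s ^ n) := mul_le_mul_of_nonneg_left hle (by positivity)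
    _ ≤ (n + u.natAbs) * (C * s ^ n) := mul_le_mul_of_nonneg_right hkn (by positivity)
    _ = C * ((n + u.natAbs) * s ^ n) := by ring
    _ ≤ C * (C' * θ ^ n) := mul_le_mul_of_nonneg_left (hC' n) hC0
    _ = C * C' * θ ^ n := by ring

lemma tendsto_distToUniform [IsLocalRing R] {ξ : PMF R} (hξ : IsSpread (weight ξ)) (u : ℤ)
    {β : ℕ → Type*} (f : ∀ n : ℕ, Matrix (Fin n) (Fin ((n : ℤ) + u).toNat) R → β n)
    (hf : ∀ n, ColInvariant (f n)) :
    Tendsto (fun n => distToUniform ξ (f n)) atTop (𝓝 0) := by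
  obtain ⟨θ, hθ, hθ1⟩ := exists_between (critRate_lt_one hξ)
  obtain ⟨C, hC⟩ := exists_distToUniform_le hξ hθ hθ1 u
  have hθ0 : 0 < θ := (critRate_pos _).trans hθ
  have hlim : Tendsto (fun n : ℕ => C * θ ^ n) atTop (𝓝 0) := by
    simpa using (tendsto_pow_atTop_nhds_zero_of_lt_one hθ0.le hθ1).const_mul C
  refine squeeze_zero' (Eventually.of_forall fun n => tvDist_nonneg _ _) ?_ hlim
  -- From here on `n + u ≥ 0`, so `toNat` does not truncate.
  filter_upwards [eventually_ge_atTop u.natAbs] with n hn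
  exact hC n _ (by omega) (f n) (hf n)

lemma tendsto_distToUniform_square [IsLocalRing R] {ξ : PMF R} (hξ : IsSpread (weight ξ))
    {β : ℕ → Type*} (f : ∀ n : ℕ, Matrix (Fin n) (Fin n) R → β n)
    (hf : ∀ n, ColInvariant (f n)) :
    Tendsto (fun n => distToUniform ξ (f n)) atTop (𝓝 0) := by
  obtain ⟨θ, hθ, hθ1⟩ := exists_between (critRate_lt_one hξ)
  obtain ⟨C, hC⟩ := exists_distToUniform_le hξ hθ hθ1 0
  have hθ0 : 0 < θ := (critRate_pos _).trans hθ
  have hlim : Tendsto (fun n : ℕ => C * θ ^ n) atTop (𝓝 0) := by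
    simpa using (tendsto_pow_atTop_nhds_zero_of_lt_one hθ0.le hθ1).const_mul C
  exact squeeze_zero (fun n => tvDist_nonneg _ _) (fun n => hC n n (by simp) (f n) (hf n)) hlim

end Matrices

end RandMat

theorem theorem1p1 {R : Type v} [CommRing R] [IsLocalRing R] [Fintype R] (ξ : PMF R)
    (hideal : ¬ RandMat.ConcentratedOnIdealTranslate ξ)
    (hsubring : ¬ RandMat.ConcentratedOnSubringTranslate ξ) :
    -- convergence to `0`; `((n : ℤ) + u).toNat` is `n + u` for all large `n`
    ((∀ u : ℤ, Tendsto (fun n : ℕ => RandMat.distToUniform ξ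
        (fun M : Matrix (Fin n) (Fin ((n : ℤ) + u).toNat) R => RandMat.cokerClass M))
        atTop (𝓝 0)) ∧
      Tendsto (fun n : ℕ => RandMat.distToUniform ξ
        (fun M : Matrix (Fin n) (Fin n) R => (RandMat.cokerClass M, M.det))) atTop (𝓝 0) ∧
      (∀ u : ℤ, Tendsto (fun n : ℕ => RandMat.distToUniform ξ
        (fun M : Matrix (Fin n) (Fin ((n : ℤ) + u).toNat) R => RandMat.colSpan M))
        atTop (𝓝 0)) ∧
      Tendsto (fun n : ℕ => RandMat.distToUniform ξ
        (fun M : Matrix (Fin n) (Fin n) R => (RandMat.colSpan M, M.det))) atTop (𝓝 0)) ∧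
    -- exponential rate
    ∀ θ : ℝ,
      max (max (RandMat.l2Norm (RandMat.modMax ξ)) (RandMat.lInfNorm (RandMat.modMax ξ)))
        (1 / (ringChar (IsLocalRing.ResidueField R) : ℝ)) < θ → θ < 1 →
      (∀ u : ℤ, ∃ C : ℝ, ∀ n k : ℕ, (k : ℤ) = n + u →
        RandMat.distToUniform ξ
          (fun M : Matrix (Fin n) (Fin k) R => RandMat.cokerClass M) ≤ C * θ ^ n) ∧
      (∃ C : ℝ, ∀ n : ℕ, RandMat.distToUniform ξ
          (fun M : Matrix (Fin n) (Fin n) R => (RandMat.cokerClass M, M.det)) ≤ C * θ ^ n) ∧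
      (∀ u : ℤ, ∃ C : ℝ, ∀ n k : ℕ, (k : ℤ) = n + u →
        RandMat.distToUniform ξ
          (fun M : Matrix (Fin n) (Fin k) R => RandMat.colSpan M) ≤ C * θ ^ n) ∧
      (∃ C : ℝ, ∀ n : ℕ, RandMat.distToUniform ξ
          (fun M : Matrix (Fin n) (Fin n) R => (RandMat.colSpan M, M.det)) ≤ C * θ ^ n) := by
  have hξ := RandMat.isSpread_weight hideal hsubring
  refine ⟨⟨fun u => ?_, ?_, fun u => ?_, ?_⟩, fun θ hθ hθ1 => ?_⟩
  · exact RandMat.tendsto_distToUniform hξ u _ fun n => RandMat.colInvariant_cokerClass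
  · exact RandMat.tendsto_distToUniform_square hξ _ fun n =>
      RandMat.colInvariant_cokerClass.prodMk RandMat.colInvariant_det
  · exact RandMat.tendsto_distToUniform hξ u _ fun n => RandMat.colInvariant_colSpan
  · exact RandMat.tendsto_distToUniform_square hξ _ fun n =>
      RandMat.colInvariant_colSpan.prodMk RandMat.colInvariant_det
  · have hcrit : RandMat.critRate (RandMat.weight ξ) < θ := by
      refine lt_of_le_of_lt ?_ hθ
      rw [RandMat.critRate, RandMat.sqrt_collision_eq_l2Norm]
      exact max_le_max (le_max_left _ _) le_rfl
    refine ⟨fun u => ?_, ?_, fun u => ?_, ?_⟩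
    · obtain ⟨C, hC⟩ := RandMat.exists_distToUniform_le hξ hcrit hθ1 u
      exact ⟨C, fun n k hk => hC n k hk _ RandMat.colInvariant_cokerClass⟩
    · obtain ⟨C, hC⟩ := RandMat.exists_distToUniform_le hξ hcrit hθ1 0
      exact ⟨C, fun n => hC n n (by simp) _
        (RandMat.colInvariant_cokerClass.prodMk RandMat.colInvariant_det)⟩
    · obtain ⟨C, hC⟩ := RandMat.exists_distToUniform_le hξ hcrit hθ1 u
      exact ⟨C, fun n k hk => hC n k hk _ RandMat.colInvariant_colSpan⟩
    · obtain ⟨C, hC⟩ := RandMat.exists_distToUniform_le hξ hcrit hθ1 0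
      exact ⟨C, fun n => hC n n (by simp) _
        (RandMat.colInvariant_colSpan.prodMk RandMat.colInvariant_det)⟩
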